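/- By a graph $G$ on $[0,n]=\{0,1,\dots,n\}$ we mean a loopless multigraph whose edges are directed from smaller to larger vertices; $E(G)$ is its multiset of edges and $\mathrm{indeg}_G(i)$ the number of edges directed into $i$. If $G$ has edges $(i,j)$ and $(j,k)$ with $i<j<k$, a reduction on them produces the three graphs with edge multisets $E(G)\setminus\{(j,k)\}\cup\{(i,k)\}$, $E(G)\setminus\{(i,j)\}\cup\{(i,k)\}$ and $E(G)\setminus\{(i,j),(j,k)\}\cup\{(i,k)\}$. A reduction tree of $G$ is a tree with root labelled $G$ in which every inner node has three children, labelled by the results of one reduction of its label, and in which the labels of the leaves cannot be reduced. $\mathrm{LD}(G)$ is the multiset of the left-degree sequences $(\mathrm{indeg}_L(1),\dots,\mathrm{indeg}_L(n))$ of the leaves $L$ of a reduction tree of $G$, and $$L_G(\mathbf t)=\sum_{\alpha\in \mathrm{LD}(G)}(-1)^{\#E(G)-\sum_i\alpha_i}\,\mathbf t^{\alpha},\qquad \mathbf t=(t_1,\dots,t_n).$$ For $k\ge 0$ let $L_G^k$ be the homogeneous component of $L_G$ of degree $\#E(G)-k$ (zero if this degree is negative). The Newton polytope $\mathrm{Newton}(f)\subseteq\mathbb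 R^n$ is the convex hull of the exponents of the monomials of $f$ with nonzero coefficient, and $f$ has polytopal support if every integer point of $\mathrm{Newton}(f)$ is the exponent of a monomial of $f$ with nonzero coefficient. Let $G\setminus 0$ be $G$ with the vertex $0$ deleted. Let $G^{\mathrm{aug}}$ be the graph on $\{1,\dots,n\}\cup\{t\}$ with edges $a_j:j\to t$ for $j\in[n]$ and, for every $e=(j,i)\in E(G\setminus 0)$ (with multiplicity), edges $z_e:j\to i$ and $y_e:j\to t$; let $\mathcal F^c_{G^{\mathrm{aug}}}$ be the polytope of nonnegative real flows on $G^{\mathrm{aug}}$ with values at most $1$ on the edges $y_e$ and with netflow (outflow minus inflow) $\mathrm{indeg}_G(j)$ at $j\in[n]$ and $-\#E(G)$ at $t$. Let $G^{(k)}$ be the graph on $\{1,\dots,n+1\}\cup\{t\}$ with the same edges, except that $y_e$ goes from $j$ to $n+1$; let $\mathcal F^c_{G^{(k)}}$ be the polytope of nonnegative real flows on $G^{(k)}$ with values at most $1$ on the edges $y_e$ and with netflow $\mathrm{indeg}_G(j)$ at $j\in[n]$, $-k$ at $n+1$ and $k-\#E(G)$ at $t$. Let $\psi$ map a flow to its values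 on $(a_1,\dots,a_n)$, and for $I\subseteq[n]$ put $z_I^{(k)}=\min\{\sum_{i\in I}f(a_i): f\in\mathcal F^c_{G^{(k)}}\}$. **Theorem B.** Let $G$ be a graph on $[0,n]$. 1. $\mathrm{LD}(G)$, and so $L_G$, does not depend on the choice of the reduction tree. 2. $\mathrm{Newton}(L_G)=\psi(\mathcal F^c_{G^{\mathrm{aug}}})$, the integer points of this polytope are exactly the elements of $\mathrm{LD}(G)$, and $L_G$ has polytopal support. 3. For every $k\ge0$, $\mathrm{Newton}(L_G^k)=\psi(\mathcal F^c_{G^{(k)}})$, the integer points of this polytope are exactly the elements of $\mathrm{LD}(G)$ with coordinate sum $\#E(G)-k$, and $L_G^k$ has polytopal support. If $L_G^k\neq0$, then the minima $z_I^{(k)}$ exist, satisfy $z_\emptyset^{(k)}=0$ and $z^{(k)}_{I\cup J}+z^{(k)}_{I\cap J}\ge z^{(k)}_I+z^{(k)}_J$ for all $I,J\subseteq[n]$, and $\mathrm{Newton}(L_G^k)$ is the generalized permutahedron $$P_n^z\{z_I^{(k)}\}=\Big\{\mathbf t\in\mathbb R^n:\ \sum_{i\in I}t_i\ge z_I^{(k)}\text{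 for } I\subsetneq[n],\ \ \sum_{i=1}^n t_i=z_{[n]}^{(k)}\Big\}.$$ 4. If $G$ is acyclic (as an undirected multigraph), then $L_G^0$ is the integer-point transform of its Newton polytope: $L_G^0(\mathbf t)=\sum_{p\in \mathrm{Newton}(L_G^0)\cap\mathbb Z^n}\mathbf t^{p}$. -/

import Mathlib

noncomputable section

open scoped BigOperators

namespace LeftDegree

/-! Graphs on the vertex set `{0, …, n}`, reduction trees, and left-degree sequences. -/

/-- A loopless multigraph on `{0, …, n}` whose edges are directed from the smaller to the larger
vertex. The edges form a multiset, so multiple edges are allowed. -/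
structure Graph (n : ℕ) where
  /-- the multiset of edges -/
  edges : Multiset (Fin (n + 1) × Fin (n + 1))
  /-- every edge goes from a smaller to a larger vertex -/
  increasing : ∀ e ∈ edges, e.1 < e.2

namespace Graph

variable {n : ℕ}

/-- The number of edges, counted with multiplicity. -/
def numEdges (G : Graph n) : ℕ := Multiset.card G.edges

/-- The number of edges directed into the vertex `v`. -/
def indeg (G : Graph n) (v : Fin (n + 1)) : ℕ := G.edges.countP (fun e => e.2 = v)

/-- The sequence `(indeg 1, …, indeg n)`; the index `i : Fin n` stands for the vertex `i + 1`. -/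
def leftDegreeSeq (G : Graph n) : Fin n → ℕ := fun i => G.indeg i.succ

/-- First reduction on the edges `(i,j)`, `(j,k)`: one copy of `(j,k)` is replaced by `(i,k)`. -/
def reduce₁ (G : Graph n) (i j k : Fin (n + 1)) (hij : (i, j) ∈ G.edges)
    (hjk : (j, k) ∈ G.edges) : Graph n where
  edges := (i, k) ::ₘ G.edges.erase (j, k)
  increasing := by
    intro e he
    rcases Multiset.mem_cons.1 he with rfl | he
    · exact lt_trans (G.increasing (i, j) hij) (G.increasing (j, k) hjk)
    · exact G.increasing _ (Multiset.mem_of_mem_erase he)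

/-- Second reduction on the edges `(i,j)`, `(j,k)`: one copy of `(i,j)` is replaced by `(i,k)`. -/
def reduce₂ (G : Graph n) (i j k : Fin (n + 1)) (hij : (i, j) ∈ G.edges)
    (hjk : (j, k) ∈ G.edges) : Graph n where
  edges := (i, k) ::ₘ G.edges.erase (i, j)
  increasing := by
    intro e he
    rcases Multiset.mem_cons.1 he with rfl | he
    · exact lt_trans (G.increasing (i, j) hij) (G.increasing (j, k) hjk)
    · exact G.increasing _ (Multiset.mem_of_mem_erase he)

/-- Third reduction on the edges `(i,j)`, `(j,k)`: one copy of each of them is deleted, and one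
edge `(i,k)` is added. -/
def reduce₃ (G : Graph n) (i j k : Fin (n + 1)) (hij : (i, j) ∈ G.edges)
    (hjk : (j, k) ∈ G.edges) : Graph n where
  edges := (i, k) ::ₘ (G.edges.erase (i, j)).erase (j, k)
  increasing := by
    intro e he
    rcases Multiset.mem_cons.1 he with rfl | he
    · exact lt_trans (G.increasing (i, j) hij) (G.increasing (j, k) hjk)
    · exact G.increasing _ (Multiset.mem_of_mem_erase (Multiset.mem_of_mem_erase he))

/-- No reduction can be performed on `G`. -/
def Irreducible (G : Graph n) : Prop :=
  ∀ i j k : Fin (n + 1), (i, j) ∈ G.edges → (j, k) ∉ G.edges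

end Graph

/-- Reduction trees with root label `G`: a leaf carries a graph that cannot be reduced, and an
inner node has three children, labelled by the results of one reduction. -/
inductive ReductionTree {n : ℕ} : Graph n → Type
  | leaf (G : Graph n) (h : G.Irreducible) : ReductionTree G
  | node (G : Graph n) (i j k : Fin (n + 1)) (hij : (i, j) ∈ G.edges) (hjk : (j, k) ∈ G.edges)
      (T₁ : ReductionTree (G.reduce₁ i j k hij hjk))
      (T₂ : ReductionTree (G.reduce₂ i j k hij hjk))
      (T₃ : ReductionTree (G.reduce₃ i j k hij hjk)) : ReductionTree G

/-- The multiset of left-degree sequences of the leaves of a reduction tree. -/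
def ReductionTree.leftDegreeSeqs {n : ℕ} : {G : Graph n} → ReductionTree G → Multiset (Fin n → ℕ)
  | _, .leaf G _ => {G.leftDegreeSeq}
  | _, .node _ _ _ _ _ _ T₁ T₂ T₃ => T₁.leftDegreeSeqs + T₂.leftDegreeSeqs + T₃.leftDegreeSeqs

/-- A quantity that drops in every reduction. -/
def Graph.potential {n : ℕ} (G : Graph n) : ℕ :=
  (G.edges.map (fun e => n + 1 + (e.1 : ℕ) - (e.2 : ℕ))).sum

theorem Graph.exists_reductionTree {n : ℕ} :
    ∀ (N : ℕ) (G : Graph n), G.potential < N → Nonempty (ReductionTree G) := by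
  intro N
  induction N with
  | zero => intro G hG; exact absurd hG (Nat.not_lt_zero _)
  | succ N ih =>
    intro G hG
    by_cases h : G.Irreducible
    · exact ⟨.leaf G h⟩
    · simp only [Graph.Irreducible, not_forall, not_not] at h
      obtain ⟨i, j, k, hij, hjk⟩ := h
      have h1 : (i : ℕ) < j := G.increasing _ hij
      have h2 : (j : ℕ) < k := G.increasing _ hjk
      have h3 : (k : ℕ) < n + 1 := k.2
      have e1 := Multiset.sum_map_erase
        (f := fun e : Fin (n + 1) × Fin (n + 1) => n + 1 + (e.1 : ℕ) - (e.2 : ℕ)) hjk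
      have e2 := Multiset.sum_map_erase
        (f := fun e : Fin (n + 1) × Fin (n + 1) => n + 1 + (e.1 : ℕ) - (e.2 : ℕ)) hij
      have hne : (j, k) ≠ (i, j) := by
        intro hc
        have h4 : (j : ℕ) = i := congrArg (fun p : Fin (n + 1) × Fin (n + 1) => (p.1 : ℕ)) hc
        omega
      have e3 := Multiset.sum_map_erase
        (f := fun e : Fin (n + 1) × Fin (n + 1) => n + 1 + (e.1 : ℕ) - (e.2 : ℕ))
        ((Multiset.mem_erase_of_ne hne).2 hjk)
      simp only [Graph.potential] at hG e1 e2 e3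
      obtain ⟨T₁⟩ := ih (G.reduce₁ i j k hij hjk) (by
        simp only [Graph.potential, Graph.reduce₁, Multiset.map_cons, Multiset.sum_cons]; omega)
      obtain ⟨T₂⟩ := ih (G.reduce₂ i j k hij hjk) (by
        simp only [Graph.potential, Graph.reduce₂, Multiset.map_cons, Multiset.sum_cons]; omega)
      obtain ⟨T₃⟩ := ih (G.reduce₃ i j k hij hjk) (by
        simp only [Graph.potential, Graph.reduce₃, Multiset.map_cons, Multiset.sum_cons]; omega)
      exact ⟨.node G i j k hij hjk T₁ T₂ T₃⟩

/-- Every graph has a reduction tree. -/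
instance {n : ℕ} (G : Graph n) : Nonempty (ReductionTree G) :=
  Graph.exists_reductionTree (G.potential + 1) G (Nat.lt_succ_self _)

namespace Graph

variable {n : ℕ}

/-- The multiset `LD(G)` of left-degree sequences of the leaves of a reduction tree of `G`. -/
def LD (G : Graph n) : Multiset (Fin n → ℕ) :=
  (Classical.arbitrary (ReductionTree G)).leftDegreeSeqs

/-- The left-degree polynomial: the sum of `(-1) ^ codim α * t ^ α` over `LD(G)`, where
`codim α` is `#E(G)` minus the sum of the entries of `α` (never negative for `α` in `LD(G)`). -/
def leftDegreePolynomial (G : Graph n) : MvPolynomial (Fin n) ℤ :=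
  (G.LD.map (fun α => (-1) ^ (G.numEdges - ∑ i, α i) * ∏ i, MvPolynomial.X i ^ α i)).sum

/-- The homogeneous component of degree `#E(G) - k` of the left-degree polynomial; it is zero if
this degree is negative. -/
def leftDegreeComponent (G : Graph n) (k : ℕ) : MvPolynomial (Fin n) ℤ :=
  if k ≤ G.numEdges then
    MvPolynomial.homogeneousComponent (G.numEdges - k) G.leftDegreePolynomial
  else 0

/-- `G` has no cycle when the directions of its edges are forgotten; two parallel edges count as
a cycle. -/
def IsAcyclic (G : Graph n) : Prop :=
  G.edges.Nodup ∧ (SimpleGraph.fromRel (fun u v => (u, v) ∈ G.edges)).IsAcyclic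

end Graph

/-! Newton polytopes. -/

/-- The Newton polytope: the convex hull of the exponent vectors of the monomials with nonzero
coefficient. -/
def newton {n : ℕ} (f : MvPolynomial (Fin n) ℤ) : Set (Fin n → ℝ) :=
  convexHull ℝ {x | ∃ m : Fin n →₀ ℕ, f.coeff m ≠ 0 ∧ x = fun i => (m i : ℝ)}

/-- Every integer point of the Newton polytope of `f` is the exponent of a monomial of `f`. -/
def HasPolytopalSupport {n : ℕ} (f : MvPolynomial (Fin n) ℤ) : Prop :=
  ∀ p : Fin n → ℤ, (fun i => (p i : ℝ)) ∈ newton f →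
    ∃ m : Fin n →₀ ℕ, (∀ i, (m i : ℤ) = p i) ∧ f.coeff m ≠ 0

/-- `f` is the integer-point transform of `P`, the sum of `t ^ p` over all integer points `p`
of `P`: no integer point of `P` has a negative coordinate, and the coefficient of `t ^ m` in `f`
is `1` if `m` lies in `P` and `0` otherwise. -/
def IsIntegerPointTransform {n : ℕ} (f : MvPolynomial (Fin n) ℤ) (P : Set (Fin n → ℝ)) : Prop :=
  (∀ p : Fin n → ℤ, (fun i => (p i : ℝ)) ∈ P → ∀ i, 0 ≤ p i) ∧
  ∀ m : Fin n →₀ ℕ,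
    ((fun i => (m i : ℝ)) ∈ P → f.coeff m = 1) ∧ ((fun i => (m i : ℝ)) ∉ P → f.coeff m = 0)

/-! Generalized permutahedra. -/

/-- The conditions on the parameters of a generalized permutahedron. -/
structure IsSupermodular {n : ℕ} (z : Finset (Fin n) → ℝ) : Prop where
  /-- the parameter of the empty set is zero -/
  empty : z ∅ = 0
  /-- supermodularity -/
  supermodular : ∀ I J : Finset (Fin n), z I + z J ≤ z (I ∪ J) + z (I ∩ J)

/-- The polytope with parameters `z`; for `z` with `IsSupermodular z` it is a generalized
permutahedron. -/
def genPermutahedron {n : ℕ} (z : Finset (Fin n) → ℝ) : Set (Fin n → ℝ) :=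
  {t | (∀ I : Finset (Fin n), I ≠ Finset.univ → z I ≤ ∑ i ∈ I, t i) ∧
    ∑ i, t i = z Finset.univ}

/-! Flows. -/

/-- The flow polytope of the directed multigraph with vertex set `V`, edges labelled by `E`, initial
vertices `ini` and final vertices `fin`, for the netflow vector `b`. -/
def flowPolytope {V E : Type} [DecidableEq V] [Fintype E] (ini fin : E → V) (b : V → ℝ) :
    Set (E → ℝ) :=
  {f | (∀ e, 0 ≤ f e) ∧
    ∀ v, (∑ e, if ini e = v then f e else 0) - (∑ e, if fin e = v then f e else 0) = b v}

namespace Graph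

variable {n : ℕ}

/-- The edges of `G` with the vertex `0` deleted. -/
def innerEdges (G : Graph n) : Multiset (Fin (n + 1) × Fin (n + 1)) :=
  G.edges.filter (fun e => e.1 ≠ 0)

/-- The edges of `G` with the vertex `0` deleted, the copies of a multiple edge being distinct. -/
abbrev InnerEdge (G : Graph n) : Type := G.innerEdges.ToType

theorem InnerEdge.fst_ne_zero {G : Graph n} (e : G.InnerEdge) : e.1.1 ≠ 0 :=
  (Multiset.mem_filter.1 (Multiset.coe_mem (m := G.innerEdges) (x := e))).2

theorem InnerEdge.snd_ne_zero {G : Graph n} (e : G.InnerEdge) : e.1.2 ≠ 0 := by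
  have h := G.increasing _
    (Multiset.mem_filter.1 (Multiset.coe_mem (m := G.innerEdges) (x := e))).1
  exact Fin.ne_zero_of_lt h

/-- The initial vertex of an edge of `G` without `0`, in the set `{1, …, n}` indexed by `Fin n`. -/
def InnerEdge.ini {G : Graph n} (e : G.InnerEdge) : Fin n := e.1.1.pred e.fst_ne_zero

/-- The final vertex of an edge of `G` without `0`, in the set `{1, …, n}` indexed by `Fin n`. -/
def InnerEdge.fin {G : Graph n} (e : G.InnerEdge) : Fin n := e.1.2.pred e.snd_ne_zero

/-- The labels of the edges of the two auxiliary graphs below: the edges `a j` for `j` in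
`{1, …, n}`, and the edges `z e` and `y e` for every edge `e` of `G` without `0`. -/
abbrev AuxEdge (G : Graph n) : Type := Fin n ⊕ (G.InnerEdge ⊕ G.InnerEdge)

/-- The edge `a j`. -/
def aEdge (G : Graph n) (j : Fin n) : G.AuxEdge := Sum.inl j

/-- The edge `y e`. -/
def yEdge (G : Graph n) (e : G.InnerEdge) : G.AuxEdge := Sum.inr (Sum.inr e)

/-- Initial vertices in the augmented graph, whose vertex set is `{1, …, n}` with an additional
sink `t`, written `⊤`: the edges `a j`, `z e`, `y e` start at `j`, `ini e`, `ini e`. -/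
def augIni (G : Graph n) : G.AuxEdge → WithTop (Fin n)
  | .inl j => (j : WithTop (Fin n))
  | .inr (.inl e) => (e.ini : WithTop (Fin n))
  | .inr (.inr e) => (e.ini : WithTop (Fin n))

/-- Final vertices in the augmented graph: the edges `a j`, `z e`, `y e` end at `t`, `fin e`,
`t`. -/
def augFin (G : Graph n) : G.AuxEdge → WithTop (Fin n)
  | .inl _ => ⊤
  | .inr (.inl e) => (e.fin : WithTop (Fin n))
  | .inr (.inr _) => ⊤

/-- The netflow vector `(indeg 1, …, indeg n, -#E(G))` on the augmented graph. -/
def augNetflow (G : Graph n) : WithTop (Fin n) → ℝ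
  | WithTop.some j => (G.indeg j.succ : ℝ)
  | ⊤ => -(G.numEdges : ℝ)

/-- The capacitated flow polytope of the augmented graph, with capacity `1` on the edges `y e`. -/
def augFlowPolytope (G : Graph n) : Set (G.AuxEdge → ℝ) :=
  {f | f ∈ flowPolytope G.augIni G.augFin G.augNetflow ∧ ∀ e, f (G.yEdge e) ≤ 1}

/-- Initial vertices in the graph `G^(k)`, whose vertex set is `{1, …, n, n + 1}` (indexed by
`Fin (n + 1)`) with an additional sink `t`, written `⊤`: the edges `a j`, `z e`, `y e` start at
`j`, `ini e`, `ini e`. -/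
def levelIni (G : Graph n) : G.AuxEdge → WithTop (Fin (n + 1))
  | .inl j => (j.castSucc : WithTop (Fin (n + 1)))
  | .inr (.inl e) => (e.ini.castSucc : WithTop (Fin (n + 1)))
  | .inr (.inr e) => (e.ini.castSucc : WithTop (Fin (n + 1)))

/-- Final vertices in the graph `G^(k)`: the edges `a j`, `z e`, `y e` end at `t`, `fin e`,
`n + 1`. -/
def levelFin (G : Graph n) : G.AuxEdge → WithTop (Fin (n + 1))
  | .inl _ => ⊤
  | .inr (.inl e) => (e.fin.castSucc : WithTop (Fin (n + 1)))
  | .inr (.inr _) => (Fin.last n : WithTop (Fin (n + 1)))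

/-- The netflow vector `(indeg 1, …, indeg n, -k, k - #E(G))` on the graph `G^(k)`. -/
def levelNetflow (G : Graph n) (k : ℕ) : WithTop (Fin (n + 1)) → ℝ
  | WithTop.some v => Fin.lastCases (motive := fun _ => ℝ) (-(k : ℝ))
      (fun j : Fin n => (G.indeg j.succ : ℝ)) v
  | ⊤ => (k : ℝ) - (G.numEdges : ℝ)

/-- The capacitated flow polytope of the graph `G^(k)`, with capacity `1` on the edges `y e`. -/
def levelFlowPolytope (G : Graph n) (k : ℕ) : Set (G.AuxEdge → ℝ) :=
  {f | f ∈ flowPolytope G.levelIni G.levelFin (G.levelNetflow k) ∧ ∀ e, f (G.yEdge e) ≤ 1}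

/-- The projection of a flow to its values on the edges `a 1, …, a n`. -/
def sinkProjection (G : Graph n) (f : G.AuxEdge → ℝ) : Fin n → ℝ := fun j => f (G.aEdge j)

/-- The values, over all capacitated flows on `G^(k)`, of the total flow on the edges `a i` with
`i` in `I`. -/
def sinkFlowValues (G : Graph n) (k : ℕ) (I : Finset (Fin n)) : Set ℝ :=
  {s | ∃ f ∈ G.levelFlowPolytope k, s = ∑ i ∈ I, f (G.aEdge i)}

/-- The least total flow on the edges `a i` with `i` in `I`. -/
def minSinkFlow (G : Graph n) (k : ℕ) (I : Finset (Fin n)) : ℝ := sInf (G.sinkFlowValues k I)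

end Graph

end LeftDegree

end

/-!
In a reduction tree, sending units of flow along the edges of `G` records the choices made at the
inner nodes: a reduction changes the labelled graph and a flow on it simultaneously, and the three
children of a node partition the integral flows. Hence the multiplicity of `α` in `LD(G)` is the
number of integral flows in `F^c(G^aug)` with values `α` on the edges `a j`, whatever the tree.

If a flow with integral netflow has a nonintegral value, the edges with such values carry a
circulation, and moving along it in both directions rounds one of them. So a flow polytope is the
convex hull of its integral flows, which describes the Newton polytopes and their integer points.

The difference of two flows decomposes along conformal paths. Projecting to the edges into the sink
yields an exchange property, by which a point minimizing coordinate sums greedily along a chain of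
subsets exists for every chain; these minimizers give supermodularity and the permutahedron.

A forest carries no nonzero circulation, so in top degree all multiplicities are one.
-/

noncomputable section

namespace LeftDegree

/-! ### Integral flows under a reduction -/

/-- The contribution of the edge `e` to the left-degree at `v` when `p.1` units of flow are sent
along `e` and `p.2` units leave the graph at the initial vertex of `e`. -/
def edgeWeight {V : Type*} [DecidableEq V] (e : V × V) (p : ℕ × ℕ) (v : V) : ℤ :=
  (if e.2 = v then 1 + (p.1 : ℤ) else 0) - (if e.1 = v then (p.1 : ℤ) + p.2 else 0)

/-- What remains at each vertex of the graph with edges `ed e`, `e ∈ s`, when every edge creates one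
unit at its final vertex and the units are moved by `f`: this is the flow into the sink. -/
def sinkValue {V ι : Type*} [DecidableEq V] (s : Finset ι) (ed : ι → V × V) (f : ι → ℕ × ℕ)
    (v : V) : ℤ :=
  ∑ e ∈ s, edgeWeight (ed e) (f e) v

/-- The integral flows on the edges `ed e`, `e ∈ s`, whose sink values belong to `A`. No flow uses
an edge starting at the root `r`, and at most one unit per edge leaves at its initial vertex. -/
def integralFlows {V ι : Type*} [DecidableEq V] (s : Finset ι) (ed : ι → V × V) (r : V)
    (A : Set (V → ℤ)) : Set (ι → ℕ × ℕ) :=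
  {f | (∀ e, e ∉ s ∨ (ed e).1 = r → f e = 0) ∧ (∀ e, (f e).2 ≤ 1) ∧ sinkValue s ed f ∈ A}

theorem sinkValue_congr {V ι : Type*} [DecidableEq V] {s : Finset ι} {ed ed' : ι → V × V}
    {f f' : ι → ℕ × ℕ}
    (h : ∀ e ∈ s, ed e = ed' e ∧ f e = f' e) : sinkValue s ed f = sinkValue s ed' f' :=
  funext fun v => Finset.sum_congr rfl fun e he => by rw [(h e he).1, (h e he).2]

section Reduction

variable {V ι : Type*} [DecidableEq V] [DecidableEq ι] {s : Finset ι} {ed : ι → V × V}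
  {r : V} {A : Set (V → ℤ)} {a b : ι} {i j k : V}

/-- A flow on the first reduction of the edges `a`, `b`, as a flow on the original graph. -/
def lift₁ (a b : ι) (f : ι → ℕ × ℕ) : ι → ℕ × ℕ :=
  Function.update f a ((f a).1 + (f b).1 + (f b).2, (f a).2)

/-- A flow on the second reduction of the edges `a`, `b`, as a flow on the original graph. -/
def lift₂ (a b : ι) (f : ι → ℕ × ℕ) : ι → ℕ × ℕ :=
  Function.update f b ((f b).1 + (f a).1 + 1, (f b).2)

/-- A flow on the third reduction of the edges `a`, `b`, as a flow on the original graph. -/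
def lift₃ (a b : ι) (f : ι → ℕ × ℕ) : ι → ℕ × ℕ :=
  Function.update f b ((f a).1, 1)

theorem sinkValue_eq_add_erase (ha : a ∈ s) (hb : b ∈ s) (hab : a ≠ b) (f : ι → ℕ × ℕ) (v : V) :
    sinkValue s ed f v = edgeWeight (ed a) (f a) v + edgeWeight (ed b) (f b) v +
      sinkValue ((s.erase a).erase b) ed f v := by
  rw [sinkValue, ← Finset.add_sum_erase s _ ha,
    ← Finset.add_sum_erase (s.erase a) _ (Finset.mem_erase.2 ⟨hab.symm, hb⟩), add_assoc, sinkValue]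

theorem sinkValue_lift₁ (ha : a ∈ s) (hb : b ∈ s) (hab : a ≠ b) (hea : ed a = (i, j))
    (heb : ed b = (j, k)) (f : ι → ℕ × ℕ) :
    sinkValue s ed (lift₁ a b f) = sinkValue s (Function.update ed b (i, k)) f := by
  funext v
  rw [sinkValue_eq_add_erase ha hb hab, sinkValue_eq_add_erase ha hb hab]
  congr 1
  · simp only [lift₁, Function.update_self, Function.update_of_ne hab,
      Function.update_of_ne hab.symm, hea, heb, edgeWeight]
    split_ifs <;> push_cast <;> ring
  · exact congrFun (sinkValue_congr fun e he => by simp_all [lift₁]) v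

theorem sinkValue_lift₂ (ha : a ∈ s) (hb : b ∈ s) (hab : a ≠ b) (hea : ed a = (i, j))
    (heb : ed b = (j, k)) (f : ι → ℕ × ℕ) :
    sinkValue s ed (lift₂ a b f) = sinkValue s (Function.update ed a (i, k)) f := by
  funext v
  rw [sinkValue_eq_add_erase ha hb hab, sinkValue_eq_add_erase ha hb hab]
  congr 1
  · simp only [lift₂, Function.update_self, Function.update_of_ne hab,
      Function.update_of_ne hab.symm, hea, heb, edgeWeight]
    split_ifs <;> push_cast <;> ring
  · exact congrFun (sinkValue_congr fun e he => by simp_all [lift₂]) v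

theorem sinkValue_lift₃ (ha : a ∈ s) (hb : b ∈ s) (hab : a ≠ b) (hea : ed a = (i, j))
    (heb : ed b = (j, k)) (f : ι → ℕ × ℕ) :
    sinkValue s ed (lift₃ a b f) = sinkValue (s.erase b) (Function.update ed a (i, k)) f := by
  funext v
  rw [sinkValue_eq_add_erase ha hb hab, Finset.erase_right_comm, sinkValue.eq_def (s.erase b),
    ← Finset.add_sum_erase (s.erase b) _ (Finset.mem_erase.2 ⟨hab, ha⟩)]
  congr 1
  · simp only [lift₃, Function.update_self, Function.update_of_ne hab, hea, heb, edgeWeight]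
    split_ifs <;> push_cast <;> ring
  · exact congrFun (sinkValue_congr fun e he => by simp_all [lift₃]) v

theorem bijOn_lift₁ (ha : a ∈ s) (hb : b ∈ s) (hab : a ≠ b) (hea : ed a = (i, j))
    (heb : ed b = (j, k)) (hj : j ≠ r) :
    Set.BijOn (lift₁ a b) (integralFlows s (Function.update ed b (i, k)) r A)
      {f ∈ integralFlows s ed r A | (f b).1 + (f b).2 ≤ (f a).1} := by
  let lower (f : ι → ℕ × ℕ) : ι → ℕ × ℕ :=
    Function.update f a ((f a).1 - (f b).1 - (f b).2, (f a).2)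
  have right_inv : ∀ f : ι → ℕ × ℕ, (f b).1 + (f b).2 ≤ (f a).1 → lift₁ a b (lower f) = f := by
    intro f hf
    funext e
    simp only [lift₁, lower, Function.update_apply]
    grind
  refine Set.InvOn.bijOn (f' := lower) ⟨fun f _ => ?_, fun f hf => right_inv f hf.2⟩ ?_ ?_
  · funext e
    simp only [lift₁, lower, Function.update_apply]
    grind
  · rintro f ⟨hsupp, hcap, hA⟩
    refine ⟨⟨fun e he => ?_, fun e => ?_, by rwa [sinkValue_lift₁ ha hb hab hea heb]⟩, ?_⟩
    · simp only [lift₁, Function.update_apply] at hsupp ⊢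
      grind [Prod.fst_zero, Prod.snd_zero]
    · simp only [lift₁, Function.update_apply]
      grind
    · simp only [lift₁, Function.update_self, Function.update_of_ne hab.symm]
      omega
  · rintro f ⟨⟨hsupp, hcap, hA⟩, hle⟩
    refine ⟨fun e he => ?_, fun e => ?_, ?_⟩
    · simp only [lower, Function.update_apply] at he ⊢
      grind [Prod.fst_zero, Prod.snd_zero]
    · simp only [lower, Function.update_apply]
      grind
    · rwa [← sinkValue_lift₁ ha hb hab hea heb, right_inv f hle]

theorem bijOn_lift₂ (ha : a ∈ s) (hb : b ∈ s) (hab : a ≠ b) (hea : ed a = (i, j))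
    (heb : ed b = (j, k)) (hj : j ≠ r) :
    Set.BijOn (lift₂ a b) (integralFlows s (Function.update ed a (i, k)) r A)
      {f ∈ integralFlows s ed r A | (f a).1 < (f b).1} := by
  let lower (f : ι → ℕ × ℕ) : ι → ℕ × ℕ := Function.update f b ((f b).1 - (f a).1 - 1, (f b).2)
  have right_inv : ∀ f : ι → ℕ × ℕ, (f a).1 < (f b).1 → lift₂ a b (lower f) = f := by
    intro f hf
    funext e
    simp only [lift₂, lower, Function.update_apply]
    grind
  refine Set.InvOn.bijOn (f' := lower) ⟨fun f _ => ?_, fun f hf => right_inv f hf.2⟩ ?_ ?_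
  · funext e
    simp only [lift₂, lower, Function.update_apply]
    grind
  · rintro f ⟨hsupp, hcap, hA⟩
    refine ⟨⟨fun e he => ?_, fun e => ?_, by rwa [sinkValue_lift₂ ha hb hab hea heb]⟩, ?_⟩
    · simp only [lift₂, Function.update_apply] at hsupp ⊢
      grind
    · simp only [lift₂, Function.update_apply]
      grind
    · simp only [lift₂, Function.update_self, Function.update_of_ne hab]
      omega
  · rintro f ⟨⟨hsupp, hcap, hA⟩, hlt⟩
    refine ⟨fun e he => ?_, fun e => ?_, ?_⟩
    · simp only [lower, Function.update_apply] at he ⊢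
      grind
    · simp only [lower, Function.update_apply]
      grind
    · rwa [← sinkValue_lift₂ ha hb hab hea heb, right_inv f hlt]

theorem bijOn_lift₃ (ha : a ∈ s) (hb : b ∈ s) (hab : a ≠ b) (hea : ed a = (i, j))
    (heb : ed b = (j, k)) (hj : j ≠ r) :
    Set.BijOn (lift₃ a b) (integralFlows (s.erase b) (Function.update ed a (i, k)) r A)
      {f ∈ integralFlows s ed r A | (f b).1 = (f a).1 ∧ (f b).2 = 1} := by
  let lower (f : ι → ℕ × ℕ) : ι → ℕ × ℕ := Function.update f b 0
  have right_inv : ∀ f : ι → ℕ × ℕ, (f b).1 = (f a).1 ∧ (f b).2 = 1 →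
      lift₃ a b (lower f) = f := by
    intro f hf
    funext e
    simp only [lift₃, lower, Function.update_apply]
    grind
  refine Set.InvOn.bijOn (f' := lower) ⟨?_, fun f hf => right_inv f hf.2⟩ ?_ ?_
  · rintro f ⟨hsupp, -, -⟩
    have hfb : f b = 0 := hsupp b (.inl (s.notMem_erase b))
    simp only [lift₃, lower, Function.update_idem, ← hfb, Function.update_eq_self]
  · rintro f ⟨hsupp, hcap, hA⟩
    refine ⟨⟨fun e he => ?_, fun e => ?_, by rwa [sinkValue_lift₃ ha hb hab hea heb]⟩, ?_⟩
    · simp only [lift₃, Function.update_apply, Finset.mem_erase] at hsupp ⊢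
      grind
    · simp only [lift₃, Function.update_apply]
      grind
    · simp only [lift₃, Function.update_self, Function.update_of_ne hab, and_self]
  · rintro f ⟨⟨hsupp, hcap, hA⟩, heq⟩
    refine ⟨fun e he => ?_, fun e => ?_, ?_⟩
    · simp only [lower, Function.update_apply, Finset.mem_erase] at he ⊢
      grind
    · simp only [lower, Function.update_apply]
      grind [Prod.snd_zero]
    · rwa [← sinkValue_lift₃ ha hb hab hea heb, right_inv f heq]

theorem encard_integralFlows_reduce (ha : a ∈ s) (hb : b ∈ s) (hab : a ≠ b) (hea : ed a = (i, j))
    (heb : ed b = (j, k)) (hj : j ≠ r) :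
    (integralFlows s ed r A).encard =
      (integralFlows s (Function.update ed b (i, k)) r A).encard +
      (integralFlows s (Function.update ed a (i, k)) r A).encard +
      (integralFlows (s.erase b) (Function.update ed a (i, k)) r A).encard := by
  have h₁ := bijOn_lift₁ (A := A) ha hb hab hea heb hj
  have h₂ := bijOn_lift₂ (A := A) ha hb hab hea heb hj
  have h₃ := bijOn_lift₃ (A := A) ha hb hab hea heb hj
  rw [← h₁.injOn.encard_image, ← h₂.injOn.encard_image, ← h₃.injOn.encard_image, h₁.image_eq,
    h₂.image_eq, h₃.image_eq, ← Set.encard_union_eq, ← Set.encard_union_eq]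
  · congr 1
    ext f
    simp only [Set.mem_union, Set.mem_ofPred_eq, ← and_or_left, iff_self_and]
    intro hf
    have : (f b).2 ≤ 1 := hf.2.1 b
    omega
  · rw [Set.disjoint_left]
    rintro f (⟨-, h⟩ | ⟨-, h⟩) ⟨-, h'⟩ <;> omega
  · rw [Set.disjoint_left]
    rintro f ⟨-, h⟩ ⟨-, h'⟩
    omega

end Reduction

theorem sinkValue_zero {V ι : Type*} [DecidableEq V] (s : Finset ι) (ed : ι → V × V) (v : V) :
    sinkValue s ed 0 v = (s.val.map ed).countP (fun e => e.2 = v) := by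
  rw [Multiset.countP_map, ← Finset.filter_val, Finset.card_val, Finset.card_filter]
  simp [sinkValue, edgeWeight]

theorem eq_zero_of_mem_integralFlows {V ι : Type*} [DecidableEq V] {s : Finset ι} {ed : ι → V × V}
    {r : V} {A : Set (V → ℤ)} (hs : ∀ e ∈ s, ∀ e' ∈ s, (ed e').2 ≠ (ed e).1)
    (hA : ∀ x ∈ A, ∀ v, v ≠ r → 0 ≤ x v) {f : ι → ℕ × ℕ} (hf : f ∈ integralFlows s ed r A) :
    f = 0 := by
  obtain ⟨hsupp, -, hfA⟩ := hf
  funext e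
  by_contra he
  obtain ⟨hes, her⟩ := not_or.1 (mt (hsupp e) he)
  rw [not_not] at hes
  have hle : ∀ e' ∈ s, edgeWeight (ed e') (f e') (ed e).1 ≤ 0 := fun e' he' => by
    rw [edgeWeight, if_neg (hs e hes e' he')]
    split_ifs <;> omega
  have hlt : edgeWeight (ed e) (f e) (ed e).1 < 0 := by
    rw [edgeWeight, if_neg (hs e hes e hes), if_pos rfl]
    have : (f e).1 ≠ 0 ∨ (f e).2 ≠ 0 := by
      contrapose! he
      exact Prod.ext he.1 he.2
    omega
  exact (hA _ hfA _ her).not_gt (Finset.sum_neg' hle ⟨e, hes, hlt⟩)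

theorem map_val_update {ι β : Type*} [DecidableEq ι] {s : Finset ι} {c : ι} (hc : c ∈ s)
    (g : ι → β) (x : β) :
    s.val.map (Function.update g c x) = x ::ₘ (s.erase c).val.map g := by
  rw [← Multiset.cons_erase hc, ← Finset.erase_val, Multiset.map_cons, Function.update_self]
  congr 1
  exact Multiset.map_congr rfl fun e he => Function.update_of_ne (Finset.ne_of_mem_erase he) _ _

theorem map_val_erase {ι β : Type*} [DecidableEq ι] [DecidableEq β] {s : Finset ι} {c : ι}
    (hc : c ∈ s) (g : ι → β) : (s.erase c).val.map g = (s.val.map g).erase (g c) := by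
  rw [Finset.erase_val, Multiset.map_erase_of_mem g _ hc]

namespace ReductionTree

variable {n : ℕ} {ι : Type*}

/-- The vectors on the vertices `0, …, n` that agree with `α` on `1, …, n`. -/
def extensions (α : Fin n → ℕ) : Set (Fin (n + 1) → ℤ) := {x | ∀ j, x j.succ = α j}

theorem encard_integralFlows_of_irreducible {G : Graph n} (hG : G.Irreducible) {s : Finset ι}
    {ed : ι → Fin (n + 1) × Fin (n + 1)} (hs : s.val.map ed = G.edges) (α : Fin n → ℕ) :
    (integralFlows s ed 0 (extensions α)).encard = if α = G.leftDegreeSeq then 1 else 0 := by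
  have mem_edges : ∀ e ∈ s, ed e ∈ G.edges := fun e he => hs ▸ Multiset.mem_map_of_mem ed he
  have eq_zero : ∀ f ∈ integralFlows s ed 0 (extensions α), f = 0 := fun f =>
    eq_zero_of_mem_integralFlows
      (fun e he e' he' h => hG _ _ (ed e).2 (mem_edges e' he') (by rw [h]; exact mem_edges e he))
      (fun x hx v hv => by
        obtain ⟨j, rfl⟩ := Fin.exists_succ_eq.2 hv
        exact (hx j).symm ▸ Int.natCast_nonneg _)
  have zero_mem : 0 ∈ integralFlows s ed 0 (extensions α) ↔ α = G.leftDegreeSeq := by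
    simp only [integralFlows, extensions, Set.mem_ofPred_eq, sinkValue_zero, hs, Pi.zero_apply,
      Prod.snd_zero, implies_true, zero_le, true_and, Nat.cast_inj, funext_iff,
      Graph.leftDegreeSeq, Graph.indeg, eq_comm]
  split_ifs with hα
  · rw [Set.eq_singleton_iff_unique_mem.2 ⟨zero_mem.2 hα, eq_zero⟩, Set.encard_singleton]
  · rw [Set.encard_eq_zero, Set.eq_empty_iff_forall_notMem]
    exact fun f hf => hα (zero_mem.1 (eq_zero f hf ▸ hf))

theorem count_leftDegreeSeqs_eq_encard_integralFlows {G : Graph n} (T : ReductionTree G)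
    (s : Finset ι) (ed : ι → Fin (n + 1) × Fin (n + 1)) (hs : s.val.map ed = G.edges)
    (α : Fin n → ℕ) :
    (T.leftDegreeSeqs.count α : ℕ∞) = (integralFlows s ed 0 (extensions α)).encard := by
  classical
  induction T generalizing s ed with
  | leaf G hG =>
    rw [encard_integralFlows_of_irreducible hG hs, leftDegreeSeqs, Multiset.count_singleton]
    split_ifs <;> rfl
  | node G i j k hij hjk T₁ T₂ T₃ ih₁ ih₂ ih₃ =>
    have i_lt_j : i < j := G.increasing _ hij
    obtain ⟨a, ha, hea⟩ := Multiset.mem_map.1 (hs ▸ hij)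
    obtain ⟨b, hb, heb⟩ := Multiset.mem_map.1 (hs ▸ hjk)
    have hab : a ≠ b := by
      rintro rfl
      exact i_lt_j.ne (congrArg Prod.fst (hea.symm.trans heb))
    have hab' : a ∈ s.erase b := Finset.mem_erase.2 ⟨hab, ha⟩
    have hba' : b ∈ s.erase a := Finset.mem_erase.2 ⟨hab.symm, hb⟩
    rw [encard_integralFlows_reduce ha hb hab hea heb (Fin.ne_zero_of_lt i_lt_j),
      ← ih₁ s _ (by rw [map_val_update hb, map_val_erase hb, hs, heb]; rfl),
      ← ih₂ s _ (by rw [map_val_update ha, map_val_erase ha, hs, hea]; rfl),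
      ← ih₃ (s.erase b) _ (by
        rw [map_val_update hab', Finset.erase_right_comm, map_val_erase hba', map_val_erase ha, hs,
          hea, heb]
        rfl)]
    simp only [leftDegreeSeqs, Multiset.count_add, Nat.cast_add]

end ReductionTree

/-! ### Integrality of flow polytopes -/

section Netflow

variable {V E : Type*} [DecidableEq V] [Fintype E] {ini fin : E → V} {f : E → ℝ}

/-- The netflow of a real vector on the edges, as a linear map. -/
def netflow (ini fin : E → V) : (E → ℝ) →ₗ[ℝ] (V → ℝ) where
  toFun f v := (∑ e, if ini e = v then f e else 0) - ∑ e, if fin e = v then f e else 0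
  map_add' f g := by
    funext v
    simp only [Pi.add_apply, ← Finset.sum_filter, Finset.sum_add_distrib]
    ring
  map_smul' c f := by
    funext v
    simp only [Pi.smul_apply, smul_eq_mul, RingHom.id_apply, ← Finset.sum_filter, Finset.mul_sum,
      mul_sub]

theorem netflow_apply (ini fin : E → V) (f : E → ℝ) (v : V) : netflow ini fin f v =
    (∑ e, if ini e = v then f e else 0) - ∑ e, if fin e = v then f e else 0 := rfl

theorem sum_netflow (ini fin : E → V) (f : E → ℝ) (C : Finset V) :
    ∑ v ∈ C, netflow ini fin f v =
      (∑ e, if ini e ∈ C then f e else 0) - ∑ e, if fin e ∈ C then f e else 0 := by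
  simp only [netflow_apply, Finset.sum_sub_distrib]
  rw [Finset.sum_comm, Finset.sum_comm (s := C)]
  simp only [Finset.sum_ite_eq]

theorem netflow_eq_zero_of_forall {v : V} (hf : ∀ e, ini e = v ∨ fin e = v → f e = 0) :
    netflow ini fin f v = 0 := by
  rw [netflow_apply, Finset.sum_eq_zero fun e _ => ite_eq_right_iff.2 fun h => hf e (.inl h),
    Finset.sum_eq_zero fun e _ => ite_eq_right_iff.2 fun h => hf e (.inr h), sub_zero]

/-- The vertices incident to an edge in `F`. -/
def endpoints (ini fin : E → V) (F : Finset E) : Finset V := F.image ini ∪ F.image fin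

omit [Fintype E] in
theorem mem_endpoints {F : Finset E} {v : V} :
    v ∈ endpoints ini fin F ↔ ∃ e ∈ F, ini e = v ∨ fin e = v := by
  simp only [endpoints, Finset.mem_union, Finset.mem_image, ← exists_or, ← and_or_left]

omit [Fintype E] in
theorem card_endpoints_le {F : Finset E}
    (hF : ∀ v ∈ endpoints ini fin F,
      2 ≤ (F.filter (ini · = v)).card + (F.filter (fin · = v)).card) :
    (endpoints ini fin F).card ≤ F.card := by
  have card_ini : F.card = ∑ v ∈ endpoints ini fin F, (F.filter (ini · = v)).card :=
    Finset.card_eq_sum_card_fiberwise fun e he => mem_endpoints.2 ⟨e, he, .inl rfl⟩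
  have card_fin : F.card = ∑ v ∈ endpoints ini fin F, (F.filter (fin · = v)).card :=
    Finset.card_eq_sum_card_fiberwise fun e he => mem_endpoints.2 ⟨e, he, .inr rfl⟩
  have := Finset.card_nsmul_le_sum _ _ 2 hF
  rw [Finset.sum_add_distrib, ← card_ini, ← card_fin, smul_eq_mul] at this
  omega

/- The flows supported on `F` with zero netflow at all endpoints but one are cut out by fewer
linear equations than there are edges. -/
theorem exists_circulation {F : Finset E} (hne : F.Nonempty)
    (hF : ∀ v ∈ endpoints ini fin F,
      2 ≤ (F.filter (ini · = v)).card + (F.filter (fin · = v)).card) :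
    ∃ d : E → ℝ, d ≠ 0 ∧ (∀ e ∉ F, d e = 0) ∧ netflow ini fin d = 0 := by
  classical
  set W := endpoints ini fin F
  have mem_W : ∀ e ∈ F, ∀ v, ini e = v ∨ fin e = v → v ∈ W := fun e he v hv =>
    mem_endpoints.2 ⟨e, he, hv⟩
  obtain ⟨e₀, he₀⟩ := hne
  set v₀ := ini e₀
  have hv₀ : v₀ ∈ W := mem_W e₀ he₀ v₀ (.inl rfl)
  let L : (E → ℝ) →ₗ[ℝ] (↥Fᶜ → ℝ) × (↥(W.erase v₀) → ℝ) :=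
    (LinearMap.funLeft ℝ ℝ Subtype.val).prod
      ((LinearMap.funLeft ℝ ℝ Subtype.val).comp (netflow ini fin))
  have hL : LinearMap.ker L ≠ ⊥ := by
    refine LinearMap.ker_ne_bot_of_finrank_lt ?_
    simp only [Module.finrank_prod, Module.finrank_fintype_fun_eq_card, Fintype.card_coe,
      Finset.card_erase_of_mem hv₀]
    have : W.card ≤ F.card := card_endpoints_le hF
    have := Finset.card_pos.2 ⟨v₀, hv₀⟩
    have := F.card_add_card_compl
    omega
  obtain ⟨d, hd, hd₀⟩ := (Submodule.ne_bot_iff _).1 hL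
  obtain ⟨hdF, hdW⟩ := Prod.mk.inj hd
  have d_off : ∀ e ∉ F, d e = 0 := fun e he => congrFun hdF ⟨e, Finset.mem_compl.2 he⟩
  have netflow_of_ne : ∀ v, v ≠ v₀ → netflow ini fin d v = 0 := by
    intro v hv
    by_cases hvW : v ∈ W
    · exact congrFun hdW ⟨v, Finset.mem_erase.2 ⟨hv, hvW⟩⟩
    · exact netflow_eq_zero_of_forall fun e he => d_off e fun heF => hvW (mem_W e heF v he)
  have sum_W : ∑ v ∈ W, netflow ini fin d v = 0 := by
    rw [sum_netflow, ← Finset.sum_sub_distrib]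
    refine Finset.sum_eq_zero fun e _ => ?_
    by_cases he : e ∈ F
    · rw [if_pos (mem_W e he _ (.inl rfl)), if_pos (mem_W e he _ (.inr rfl)), sub_self]
    · simp only [d_off e he, ite_self, sub_self]
  refine ⟨d, hd₀, d_off, funext fun v => ?_⟩
  by_cases hv : v = v₀
  · rwa [Finset.sum_eq_single_of_mem v₀ hv₀ fun v _ => netflow_of_ne v, ← hv] at sum_W
  · exact netflow_of_ne v hv

/-- The integers, as a subgroup of the reals. -/
def intSubgroup : AddSubgroup ℝ := (Int.castAddHom ℝ).range

theorem mem_intSubgroup {x : ℝ} : x ∈ intSubgroup ↔ ∃ m : ℤ, (m : ℝ) = x := Iff.rfl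

theorem intCast_mem_intSubgroup (m : ℤ) : (m : ℝ) ∈ intSubgroup := ⟨m, rfl⟩

theorem natCast_mem_intSubgroup (m : ℕ) : (m : ℝ) ∈ intSubgroup := ⟨m, Int.cast_natCast m⟩

open scoped Classical in
/-- The coordinates of `f` that are not integers. -/
def fractional (f : E → ℝ) : Finset E := {e | f e ∉ intSubgroup}

theorem mem_fractional {e : E} : e ∈ fractional f ↔ f e ∉ intSubgroup := by
  simp only [fractional, Finset.mem_filter, Finset.mem_univ, true_and]

theorem sum_sub_sum_fractional_mem (f : E → ℝ) (p : E → Prop) [DecidablePred p] :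
    (∑ e, if p e then f e else 0) - ∑ e ∈ (fractional f).filter p, f e ∈ intSubgroup := by
  classical
  rw [← Finset.sum_filter, ← Finset.sum_sdiff (Finset.filter_subset_filter p
    (Finset.subset_univ (fractional f))), add_sub_cancel_right]
  refine sum_mem fun e he => ?_
  by_contra h
  simp only [Finset.mem_sdiff, Finset.mem_filter, mem_fractional] at he
  exact he.2 ⟨h, he.1.2⟩

theorem two_le_card_fractional {v : V} (hv : v ∈ endpoints ini fin (fractional f))
    (hf : netflow ini fin f v ∈ intSubgroup) :
    2 ≤ ((fractional f).filter (ini · = v)).card + ((fractional f).filter (fin · = v)).card := by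
  set A := (fractional f).filter (ini · = v)
  set B := (fractional f).filter (fin · = v)
  have pos : A.Nonempty ∨ B.Nonempty := by
    obtain ⟨e, he, h | h⟩ := mem_endpoints.1 hv
    · exact .inl ⟨e, Finset.mem_filter.2 ⟨he, h⟩⟩
    · exact .inr ⟨e, Finset.mem_filter.2 ⟨he, h⟩⟩
  have sum_mem : ∑ e ∈ A, f e - ∑ e ∈ B, f e ∈ intSubgroup := by
    have := intSubgroup.sub_mem hf (intSubgroup.sub_mem (sum_sub_sum_fractional_mem f (ini · = v))
      (sum_sub_sum_fractional_mem f (fin · = v)))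
    rw [netflow_apply] at this
    convert this using 1
    ring
  by_contra! hlt
  rw [← Finset.card_pos, ← Finset.card_pos] at pos
  obtain ⟨hA₁, hB₀⟩ | ⟨hA₀, hB₁⟩ : A.card = 1 ∧ B.card = 0 ∨ A.card = 0 ∧ B.card = 1 := by omega
  · obtain ⟨e, he⟩ := Finset.card_eq_one.1 hA₁
    rw [he, Finset.card_eq_zero.1 hB₀, Finset.sum_singleton, Finset.sum_empty, sub_zero] at sum_mem
    have : e ∈ A := he ▸ Finset.mem_singleton_self e
    exact mem_fractional.1 (Finset.mem_filter.1 this).1 sum_mem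
  · obtain ⟨e, he⟩ := Finset.card_eq_one.1 hB₁
    rw [he, Finset.card_eq_zero.1 hA₀, Finset.sum_singleton, Finset.sum_empty, zero_sub,
      intSubgroup.neg_mem_iff] at sum_mem
    have : e ∈ B := he ▸ Finset.mem_singleton_self e
    exact mem_fractional.1 (Finset.mem_filter.1 this).1 sum_mem

theorem exists_time_to_integer {x d : ℝ} (hx : x ∉ intSubgroup) (hd : d ≠ 0) :
    ∃ t, 0 < t ∧ x + t * d ∈ intSubgroup ∧
      ∀ s, 0 ≤ s → s ≤ t → (⌊x⌋ : ℝ) ≤ x + s * d ∧ x + s * d ≤ ⌈x⌉ := by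
  have floor_lt : (⌊x⌋ : ℝ) < x :=
    (Int.floor_le x).lt_of_ne fun h => hx (h ▸ intCast_mem_intSubgroup _)
  have lt_ceil : x < ⌈x⌉ := (Int.le_ceil x).lt_of_ne fun h => hx (h ▸ intCast_mem_intSubgroup _)
  rcases hd.lt_or_gt with hd | hd
  · refine ⟨(⌊x⌋ - x) / d, div_pos_of_neg_of_neg (sub_neg.2 floor_lt) hd, ?_, fun s hs hst => ?_⟩
    · rw [div_mul_cancel₀ _ hd.ne, add_sub_cancel]
      exact intCast_mem_intSubgroup _
    · rw [le_div_iff_of_neg hd] at hst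
      have := mul_nonpos_of_nonneg_of_nonpos hs hd.le
      constructor <;> linarith
  · refine ⟨(⌈x⌉ - x) / d, div_pos (sub_pos.2 lt_ceil) hd, ?_, fun s hs hst => ?_⟩
    · rw [div_mul_cancel₀ _ hd.ne', add_sub_cancel]
      exact intCast_mem_intSubgroup _
    · rw [le_div_iff₀ hd] at hst
      have := mul_nonneg hs hd.le
      constructor <;> linarith

theorem exists_step_to_integer {d : E → ℝ} (hd : d ≠ 0) (hsupp : ∀ e ∉ fractional f, d e = 0) :
    ∃ t, 0 < t ∧ (∀ e, (⌊f e⌋ : ℝ) ≤ f e + t * d e ∧ f e + t * d e ≤ ⌈f e⌉) ∧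
      ∃ e ∈ fractional f, f e + t * d e ∈ intSubgroup := by
  classical
  have mem_of_ne : ∀ e, d e ≠ 0 → e ∈ fractional f := fun e => by
    contrapose!
    exact hsupp e
  have time : ∀ e, ∃ t, d e ≠ 0 → 0 < t ∧ f e + t * d e ∈ intSubgroup ∧
      ∀ s, 0 ≤ s → s ≤ t → (⌊f e⌋ : ℝ) ≤ f e + s * d e ∧ f e + s * d e ≤ ⌈f e⌉ := by
    intro e
    by_cases he : d e = 0
    · exact ⟨0, fun h => absurd he h⟩
    · obtain ⟨t, ht⟩ := exists_time_to_integer (mem_fractional.1 (mem_of_ne e he)) he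
      exact ⟨t, fun _ => ht⟩
  choose τ hτ using time
  obtain ⟨e₁, he₁⟩ := Function.ne_iff.1 hd
  obtain ⟨e₀, he₀, hmin⟩ := Finset.exists_min_image (Finset.univ.filter (d · ≠ 0)) τ
    ⟨e₁, Finset.mem_filter.2 ⟨Finset.mem_univ _, he₁⟩⟩
  obtain ⟨t_pos, t_mem, -⟩ := hτ e₀ (Finset.mem_filter.1 he₀).2
  refine ⟨τ e₀, t_pos, fun e => ?_, e₀, mem_of_ne e₀ (Finset.mem_filter.1 he₀).2, t_mem⟩
  by_cases he : d e = 0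
  · rw [he, mul_zero, add_zero]
    exact ⟨Int.floor_le _, Int.le_ceil _⟩
  · exact (hτ e he).2.2 _ t_pos.le (hmin e (Finset.mem_filter.2 ⟨Finset.mem_univ _, he⟩))

/-- The integral vectors with the same netflow as `f` in the smallest integral box around `f`. -/
def roundings (ini fin : E → V) (f : E → ℝ) : Set (E → ℝ) :=
  {g | (∀ e, g e ∈ intSubgroup) ∧ netflow ini fin g = netflow ini fin f ∧
    ∀ e, (⌊f e⌋ : ℝ) ≤ g e ∧ g e ≤ ⌈f e⌉}

theorem exists_roundings_subset {d : E → ℝ} (hd : d ≠ 0) (hsupp : ∀ e ∉ fractional f, d e = 0)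
    (hcirc : netflow ini fin d = 0) :
    ∃ t : ℝ, 0 < t ∧ (fractional (f + t • d)).card < (fractional f).card ∧
      roundings ini fin (f + t • d) ⊆ roundings ini fin f := by
  obtain ⟨t, ht, hbox, e₀, he₀, hint⟩ := exists_step_to_integer hd hsupp
  refine ⟨t, ht, Finset.card_lt_card ⟨fun e he => ?_, fun h => mem_fractional.1 (h he₀) hint⟩, ?_⟩
  · by_contra hef
    rw [mem_fractional, Pi.add_apply, Pi.smul_apply, hsupp e hef, smul_zero, add_zero] at he
    exact hef (mem_fractional.2 he)
  · rintro g ⟨g_int, g_netflow, g_box⟩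
    refine ⟨g_int, by rw [g_netflow, map_add, map_smul, hcirc, smul_zero, add_zero], fun e => ?_⟩
    exact ⟨le_trans (mod_cast Int.le_floor.2 (hbox e).1) (g_box e).1,
      (g_box e).2.trans (mod_cast Int.ceil_le.2 (hbox e).2)⟩

theorem mem_segment_add_smul_sub_smul {F : Type*} [AddCommGroup F] [Module ℝ F] (x d : F) {t u : ℝ}
    (ht : 0 < t) (hu : 0 < u) : x ∈ segment ℝ (x + t • d) (x + u • -d) := by
  refine ⟨u / (t + u), t / (t + u), by positivity, by positivity, by field_simp; ring, ?_⟩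
  match_scalars <;> field_simp <;> ring

theorem mem_convexHull_roundings (hf : ∀ v, netflow ini fin f v ∈ intSubgroup) :
    f ∈ convexHull ℝ (roundings ini fin f) := by
  induction hN : (fractional f).card using Nat.strong_induction_on generalizing f with
  | _ N ih =>
    rcases (fractional f).eq_empty_or_nonempty with hF | hF
    · refine subset_convexHull ℝ _ ⟨fun e => ?_, rfl, fun e => ⟨Int.floor_le _, Int.le_ceil _⟩⟩
      by_contra he
      exact Finset.notMem_empty e (hF ▸ mem_fractional.2 he)
    · obtain ⟨d, hd, hsupp, hcirc⟩ :=
        exists_circulation hF fun v hv => two_le_card_fractional hv (hf v)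
      have step : ∀ d : E → ℝ, d ≠ 0 → (∀ e ∉ fractional f, d e = 0) → netflow ini fin d = 0 →
          ∃ t : ℝ, 0 < t ∧ f + t • d ∈ convexHull ℝ (roundings ini fin f) := by
        intro d hd hsupp hcirc
        obtain ⟨t, ht, hcard, hsub⟩ := exists_roundings_subset hd hsupp hcirc
        refine ⟨t, ht, convexHull_mono hsub (ih _ (hN ▸ hcard) (fun v => ?_) rfl)⟩
        rw [map_add, map_smul, hcirc, smul_zero, add_zero]
        exact hf v
      obtain ⟨t, ht, h_add⟩ := step d hd hsupp hcirc
      obtain ⟨u, hu, h_sub⟩ := step (-d) (neg_ne_zero.2 hd)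
        (fun e he => by rw [Pi.neg_apply, hsupp e he, neg_zero]) (by rw [map_neg, hcirc, neg_zero])
      exact (convex_convexHull ℝ _).segment_subset h_add h_sub
        (mem_segment_add_smul_sub_smul f d ht hu)

end Netflow

/-- A vector of natural numbers, as a real vector. -/
def toReal {ι : Type*} (m : ι → ℕ) : ι → ℝ := fun i => m i

section CappedFlows

variable {V E : Type} [DecidableEq V] [Fintype E] {ini fin : E → V} {b : V → ℝ} {C : Set E}
  {f : E → ℝ}

/-- The flows with netflow `b` and with values at most `1` on the edges in `C`. -/
def cappedFlows (ini fin : E → V) (b : V → ℝ) (C : Set E) : Set (E → ℝ) :=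
  {f | f ∈ flowPolytope ini fin b ∧ ∀ e ∈ C, f e ≤ 1}

theorem mem_cappedFlows : f ∈ cappedFlows ini fin b C ↔
    (∀ e, 0 ≤ f e) ∧ netflow ini fin f = b ∧ ∀ e ∈ C, f e ≤ 1 := by
  simp only [cappedFlows, flowPolytope, Set.mem_ofPred_eq, funext_iff, netflow_apply, and_assoc]

theorem convex_cappedFlows : Convex ℝ (cappedFlows ini fin b C) := by
  intro f hf g hg s t hs ht hst
  rw [mem_cappedFlows] at hf hg ⊢
  refine ⟨fun e => ?_, ?_, fun e he => ?_⟩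
  · exact add_nonneg (mul_nonneg hs (hf.1 e)) (mul_nonneg ht (hg.1 e))
  · rw [map_add, map_smul, map_smul, hf.2.1, hg.2.1, ← add_smul, hst, one_smul]
  · exact (convex_Iic (1 : ℝ)) (hf.2.2 e he) (hg.2.2 e he) hs ht hst

theorem roundings_subset_cappedFlows (hf : f ∈ cappedFlows ini fin b C) :
    roundings ini fin f ⊆ toReal '' {m | toReal m ∈ cappedFlows ini fin b C} := by
  rw [mem_cappedFlows] at hf
  rintro g ⟨g_int, g_netflow, g_box⟩
  have g_nonneg : ∀ e, 0 ≤ g e := fun e =>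
    le_trans (mod_cast Int.floor_nonneg.2 (hf.1 e)) (g_box e).1
  have g_mem : g ∈ cappedFlows ini fin b C := mem_cappedFlows.2 ⟨g_nonneg, g_netflow.trans hf.2.1,
    fun e he => (g_box e).2.trans (mod_cast Int.ceil_le.2 (mod_cast hf.2.2 e he))⟩
  have exists_nat : ∀ e, ∃ m : ℕ, (m : ℝ) = g e := fun e => by
    obtain ⟨m, hm⟩ := mem_intSubgroup.1 (g_int e)
    have hm₀ : 0 ≤ m := Int.cast_nonneg_iff.1 (hm.symm ▸ g_nonneg e)
    exact ⟨m.toNat, by rw [← hm, ← Int.toNat_of_nonneg hm₀, Int.cast_natCast, Int.toNat_natCast]⟩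
  choose m hm using exists_nat
  have hg : toReal m = g := funext hm
  exact ⟨m, by rwa [Set.mem_ofPred_eq, hg], hg⟩

theorem cappedFlows_eq_convexHull (hb : ∀ v, b v ∈ intSubgroup) :
    cappedFlows ini fin b C =
      convexHull ℝ (toReal '' {m | toReal m ∈ cappedFlows ini fin b C}) := by
  refine Set.Subset.antisymm (fun f hf => ?_) (convexHull_min ?_ convex_cappedFlows)
  · refine convexHull_mono (roundings_subset_cappedFlows hf) (mem_convexHull_roundings fun v => ?_)
    rw [(mem_cappedFlows.1 hf).2.1]
    exact hb v
  · rintro _ ⟨m, hm, rfl⟩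
    exact hm

theorem exists_natFlow_eq_on_integers (hb : ∀ v, b v ∈ intSubgroup)
    (hf : f ∈ cappedFlows ini fin b C) :
    ∃ m : E → ℕ, toReal m ∈ cappedFlows ini fin b C ∧ ∀ e, f e ∈ intSubgroup → (m e : ℝ) = f e := by
  have f_mem : f ∈ convexHull ℝ (roundings ini fin f) := mem_convexHull_roundings fun v => by
    rw [(mem_cappedFlows.1 hf).2.1]
    exact hb v
  obtain ⟨g, hg⟩ := convexHull_nonempty_iff.1 ⟨f, f_mem⟩
  obtain ⟨m, hm, rfl⟩ := roundings_subset_cappedFlows hf hg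
  refine ⟨m, hm, fun e he => ?_⟩
  obtain ⟨k, hk⟩ := he
  have box : (⌊f e⌋ : ℝ) ≤ m e ∧ (m e : ℝ) ≤ ⌈f e⌉ := hg.2.2 e
  rw [← hk, Int.coe_castAddHom, Int.floor_intCast, Int.ceil_intCast] at box
  rw [← hk]
  exact le_antisymm box.2 box.1

end CappedFlows

/-! ### Generalized permutahedra -/

section Superlevel

variable {ι : Type*} [Fintype ι] {w x : ι → ℝ}

/- Layer cake: `w i - m` is the length of the set of all `c` in `[m, M]` with `c ≤ w i`. -/
theorem dotProduct_nonneg_of_superlevel (hx : ∀ c, 0 ≤ ∑ i with c ≤ w i, x i)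
    (hx₀ : ∑ i, x i = 0) : 0 ≤ w ⬝ᵥ x := by
  obtain ⟨m, hm⟩ := (Set.finite_range w).bddBelow
  obtain ⟨M, hM⟩ := (Set.finite_range w).bddAbove
  rw [mem_lowerBounds, Set.forall_mem_range] at hm
  rw [mem_upperBounds, Set.forall_mem_range] at hM
  let layer (i : ι) : ℝ → ℝ := {c | c ≤ w i}.indicator fun _ => x i
  have integral_layer : ∀ i, ∫ c in m..M, layer i c = (w i - m) * x i := fun i => by
    rw [intervalIntegral.integral_indicator ⟨hm i, hM i⟩, intervalIntegral.integral_const,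
      smul_eq_mul]
  have integrable_layer : ∀ i, IntervalIntegrable (layer i) MeasureTheory.volume m M := fun i =>
    ⟨intervalIntegrable_const.1.indicator measurableSet_Iic,
      intervalIntegrable_const.2.indicator measurableSet_Iic⟩
  have sum_eq : w ⬝ᵥ x = ∑ i, (w i - m) * x i := by
    simp only [sub_mul, Finset.sum_sub_distrib, ← Finset.mul_sum, hx₀, mul_zero, sub_zero,
      dotProduct]
  rcases isEmpty_or_nonempty ι with hι | ⟨⟨i₀⟩⟩
  · rw [dotProduct, Fintype.sum_empty]
  · rw [sum_eq, ← Finset.sum_congr rfl fun i _ => integral_layer i,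
      ← intervalIntegral.integral_finsetSum fun i _ => integrable_layer i]
    refine intervalIntegral.integral_nonneg ((hm i₀).trans (hM i₀)) fun c _ => ?_
    simpa only [layer, Set.indicator_apply, Set.mem_ofPred_eq, ← Finset.sum_filter] using hx c

end Superlevel

section Exchange

variable {ι : Type*} [Fintype ι] [DecidableEq ι]

/-- If the coordinate sum over `I` at `y` exceeds that of another point of `S`, then some weight at
`y` can be moved out of `I` without leaving `S`. -/
def HasExchange (S : Set (ι → ℝ)) : Prop :=
  ∀ x ∈ S, ∀ y ∈ S, ∀ I : Finset ι, ∑ i ∈ I, x i < ∑ i ∈ I, y i →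
    ∃ i ∈ I, ∃ j ∉ I, ∃ ε : ℝ, 0 < ε ∧ y + ε • (Pi.single j 1 - Pi.single i 1) ∈ S

/-- For every linear functional `w` some point of `S` minimizes the coordinate sums over all
superlevel sets of `w` simultaneously. -/
def HasGreedyMinimizers (S : Set (ι → ℝ)) : Prop :=
  ∀ w : ι → ℝ, ∃ g ∈ S, ∀ t ∈ S, ∀ c : ℝ, ∑ i with c ≤ w i, g i ≤ ∑ i with c ≤ w i, t i

variable {S : Set (ι → ℝ)}

theorem HasExchange.sum_eq (hS : HasExchange S) {x y : ι → ℝ} (hx : x ∈ S) (hy : y ∈ S) :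
    ∑ i, x i = ∑ i, y i := by
  have sum_le : ∀ x ∈ S, ∀ y ∈ S, ∑ i, y i ≤ ∑ i, x i := fun x hx y hy => by
    by_contra! h
    obtain ⟨-, -, j, hj, -⟩ := hS x hx y hy Finset.univ h
    exact hj (Finset.mem_univ j)
  exact (sum_le y hy x hx).antisymm (sum_le x hx y hy)

theorem HasExchange.hasGreedyMinimizers (hS : HasExchange S) (hc : IsCompact S)
    (hne : S.Nonempty) : HasGreedyMinimizers S := by
  intro w
  obtain ⟨g, hg, hmin⟩ := hc.exists_isMinOn hne
    (f := fun t => w ⬝ᵥ t) (continuous_const.dotProduct continuous_id).continuousOn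
  refine ⟨g, hg, fun t ht c => ?_⟩
  by_contra! hlt
  obtain ⟨i, hi, j, hj, ε, hε, hmem⟩ := hS t ht g hg _ hlt
  have hle : w ⬝ᵥ g ≤ w ⬝ᵥ (g + ε • (Pi.single j 1 - Pi.single i 1)) := hmin hmem
  rw [dotProduct_add, dotProduct_smul, dotProduct_sub, dotProduct_single_one,
    dotProduct_single_one, le_add_iff_nonneg_right, smul_eq_mul, mul_nonneg_iff_of_pos_left hε,
    sub_nonneg] at hle
  simp only [Finset.mem_filter, Finset.mem_univ, true_and, not_le] at hi hj
  exact (hj.trans_le hi).not_ge hle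

end Exchange

section GenPermutahedron

variable {n : ℕ} {S : Set (Fin n → ℝ)}

/-- The least coordinate sums over the subsets of `Fin n` on `S`. -/
def minCoordSum (S : Set (Fin n → ℝ)) (I : Finset (Fin n)) : ℝ :=
  sInf ((fun t => ∑ i ∈ I, t i) '' S)

theorem HasGreedyMinimizers.isLeast (hS : HasGreedyMinimizers S) (I : Finset (Fin n)) :
    IsLeast ((fun t => ∑ i ∈ I, t i) '' S) (minCoordSum S I) := by
  obtain ⟨g, hg, hmin⟩ := hS fun i => if i ∈ I then 1 else 0
  have superlevel : (Finset.univ.filter fun i => (1 : ℝ) ≤ if i ∈ I then 1 else 0) = I := by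
    ext i
    by_cases h : i ∈ I <;> simp [h]
  have least : IsLeast ((fun t => ∑ i ∈ I, t i) '' S) (∑ i ∈ I, g i) := by
    refine ⟨⟨g, hg, rfl⟩, ?_⟩
    rintro _ ⟨t, ht, rfl⟩
    simpa only [superlevel] using hmin t ht 1
  rwa [minCoordSum, least.csInf_eq]

theorem HasGreedyMinimizers.isSupermodular (hS : HasGreedyMinimizers S) :
    IsSupermodular (minCoordSum S) where
  empty := by
    obtain ⟨t, -, ht⟩ := (hS.isLeast ∅).1
    exact ht.symm
  supermodular I J := by
    let w (i : Fin n) : ℝ := (if i ∈ I then 1 else 0) + if i ∈ J then 1 else 0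
    obtain ⟨g, hg, hmin⟩ := hS w
    have superlevel_one : (Finset.univ.filter fun i => 1 ≤ w i) = I ∪ J := by
      ext i
      by_cases hI : i ∈ I <;> by_cases hJ : i ∈ J <;> simp [w, hI, hJ]
    have superlevel_two : (Finset.univ.filter fun i => 2 ≤ w i) = I ∩ J := by
      ext i
      by_cases hI : i ∈ I <;> by_cases hJ : i ∈ J <;> norm_num [w, hI, hJ]
    have le_union : ∑ i ∈ I ∪ J, g i ≤ minCoordSum S (I ∪ J) := by
      obtain ⟨t, ht, heq⟩ := (hS.isLeast (I ∪ J)).1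
      simpa only [superlevel_one, heq] using hmin t ht 1
    have le_inter : ∑ i ∈ I ∩ J, g i ≤ minCoordSum S (I ∩ J) := by
      obtain ⟨t, ht, heq⟩ := (hS.isLeast (I ∩ J)).1
      simpa only [superlevel_two, heq] using hmin t ht 2
    calc minCoordSum S I + minCoordSum S J ≤ ∑ i ∈ I, g i + ∑ i ∈ J, g i :=
          add_le_add ((hS.isLeast I).2 ⟨g, hg, rfl⟩) ((hS.isLeast J).2 ⟨g, hg, rfl⟩)
      _ = ∑ i ∈ I ∪ J, g i + ∑ i ∈ I ∩ J, g i := Finset.sum_union_inter.symm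
      _ ≤ minCoordSum S (I ∪ J) + minCoordSum S (I ∩ J) := add_le_add le_union le_inter

theorem HasExchange.eq_genPermutahedron (hS : HasExchange S) (hc : IsCompact S)
    (hne : S.Nonempty) (hconv : Convex ℝ S) : S = genPermutahedron (minCoordSum S) := by
  have greedy := hS.hasGreedyMinimizers hc hne
  have sum_univ : ∀ x ∈ S, ∑ i, x i = minCoordSum S Finset.univ := fun x hx => by
    obtain ⟨t, ht, heq⟩ := (greedy.isLeast Finset.univ).1
    exact (hS.sum_eq hx ht).trans heq
  refine Set.Subset.antisymm
    (fun x hx => ⟨fun I _ => (greedy.isLeast I).2 ⟨x, hx, rfl⟩, sum_univ x hx⟩) ?_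
  rintro t ⟨ht, ht_univ⟩
  have min_le : ∀ I, minCoordSum S I ≤ ∑ i ∈ I, t i := fun I => by
    by_cases hI : I = Finset.univ
    · exact hI ▸ ht_univ.ge
    · exact ht I hI
  by_contra htS
  obtain ⟨φ, u, htu, hu⟩ := geometric_hahn_banach_point_closed hconv hc.isClosed htS
  obtain ⟨w, hw⟩ := (dotProductEquiv ℝ (Fin n)).surjective φ
  have φ_eq : ∀ x, φ x = w ⬝ᵥ x := fun x => (LinearMap.congr_fun hw x).symm
  obtain ⟨g, hg, hmin⟩ := greedy w
  have dot_nonneg : 0 ≤ w ⬝ᵥ (t - g) := by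
    refine dotProduct_nonneg_of_superlevel (fun c => ?_) ?_
    · obtain ⟨s, hs, heq⟩ := (greedy.isLeast (Finset.univ.filter fun i => c ≤ w i)).1
      simp only [Pi.sub_apply, Finset.sum_sub_distrib, sub_nonneg]
      exact (hmin s hs c).trans (heq.trans_le (min_le _))
    · simp only [Pi.sub_apply, Finset.sum_sub_distrib, ht_univ, sum_univ g hg, sub_self]
  rw [dotProduct_sub, sub_nonneg, ← φ_eq, ← φ_eq] at dot_nonneg
  exact (htu.trans (hu g hg)).not_ge dot_nonneg

end GenPermutahedron

/-! ### Exchange along conformal paths -/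

section Conformal

variable {V E : Type*} {ini fin : E → V} {d q : E → ℝ}

/-- `q` has the sign of `d` wherever it does not vanish. -/
def IsConformal (d q : E → ℝ) : Prop := ∀ e, q e = 0 ∨ 0 < d e * q e

theorem IsConformal.add {q' : E → ℝ} (hq : IsConformal d q) (hq' : IsConformal d q') :
    IsConformal d (q + q') := fun e => by
  rw [Pi.add_apply, mul_add]
  rcases hq e with h | h <;> rcases hq' e with h' | h'
  · exact .inl (by rw [h, h', add_zero])
  · exact .inr (by rwa [h, mul_zero, zero_add])
  · exact .inr (by rwa [h', mul_zero, add_zero])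
  · exact .inr (add_pos h h')

theorem isConformal_single [DecidableEq E] {e : E} {c : ℝ} (h : 0 < d e * c) :
    IsConformal d (Pi.single e c) := fun e' => by
  obtain rfl | he := eq_or_ne e' e
  · exact .inr (by rwa [Pi.single_eq_same])
  · exact .inl (by rw [Pi.single_eq_of_ne he])

theorem IsConformal.exists_add_smul_mem_uIcc [Finite E] {f g : E → ℝ}
    (hq : IsConformal (f - g) q) :
    ∃ ε : ℝ, 0 < ε ∧ ∀ e, g e + ε * q e ∈ Set.uIcc (g e) (f e) := by
  have eventually_mem : ∀ e, ∀ᶠ ε in nhdsWithin (0 : ℝ) (Set.Ioi 0),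
      g e + ε * q e ∈ Set.uIcc (g e) (f e) := fun e => by
    have tendsto : Filter.Tendsto (fun ε => g e + ε * q e) (nhdsWithin 0 (Set.Ioi 0))
        (nhds (g e)) := by
      refine (Continuous.tendsto' (by fun_prop) 0 (g e) ?_).mono_left nhdsWithin_le_nhds
      rw [zero_mul, add_zero]
    rcases hq e with h | h
    · exact .of_forall fun ε => by rw [h, mul_zero, add_zero]; exact Set.left_mem_uIcc
    rcases mul_pos_iff.1 h with ⟨hd, hq⟩ | ⟨hd, hq⟩
    · filter_upwards [tendsto.eventually_lt_const (sub_pos.1 hd), self_mem_nhdsWithin] with ε h hε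
      exact Set.mem_uIcc_of_le (le_add_of_nonneg_right (mul_pos hε hq).le) h.le
    · filter_upwards [tendsto.eventually_const_lt (sub_neg.1 hd), self_mem_nhdsWithin] with ε h hε
      exact Set.mem_uIcc_of_ge h.le (add_le_of_nonpos_right (mul_neg_of_pos_of_neg hε hq).le)
  obtain ⟨ε, h, hε⟩ := ((Filter.eventually_all.2 eventually_mem).and self_mem_nhdsWithin).exists
  exact ⟨ε, hε, h⟩

/-- A step from `u` to `v` along an edge, in the direction in which `d` flows through that edge. -/
def FlowStep (ini fin : E → V) (d : E → ℝ) (u v : V) : Prop :=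
  ∃ e, ini e = u ∧ fin e = v ∧ 0 < d e ∨ fin e = u ∧ ini e = v ∧ d e < 0

variable [DecidableEq V] [Fintype E]

theorem netflow_single [DecidableEq E] (ini fin : E → V) (e : E) (c : ℝ) :
    netflow ini fin (Pi.single e c) = c • (Pi.single (ini e) 1 - Pi.single (fin e) 1) := by
  funext v
  rw [netflow_apply, Fintype.sum_eq_single e, Fintype.sum_eq_single e]
  · simp [Pi.single_apply, eq_comm, mul_sub]
  all_goals exact fun e' he => ite_eq_right_iff.2 fun _ => by rw [Pi.single_eq_of_ne he]

theorem exists_isConformal_of_reflTransGen {u v : V}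
    (h : Relation.ReflTransGen (FlowStep ini fin d) u v) :
    ∃ p, IsConformal d p ∧ netflow ini fin p = Pi.single u 1 - Pi.single v 1 := by
  classical
  induction h with
  | refl => exact ⟨0, fun e => .inl rfl, by rw [map_zero, sub_self]⟩
  | tail _ hstep ih =>
    obtain ⟨p, hp, hnet⟩ := ih
    obtain ⟨e, ⟨rfl, rfl, he⟩ | ⟨rfl, rfl, he⟩⟩ := hstep
    · refine ⟨p + Pi.single e 1, hp.add (isConformal_single (by rwa [mul_one])), ?_⟩
      rw [map_add, hnet, netflow_single, one_smul, sub_add_sub_cancel]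
    · refine ⟨p + Pi.single e (-1), hp.add (isConformal_single (by linarith)), ?_⟩
      rw [map_add, hnet, netflow_single, neg_one_smul, neg_sub, sub_add_sub_cancel]

theorem sum_netflow_nonpos_of_closed {C : Finset V}
    (hC : ∀ u ∈ C, ∀ v, FlowStep ini fin d u v → v ∈ C) : ∑ v ∈ C, netflow ini fin d v ≤ 0 := by
  rw [sum_netflow, ← Finset.sum_sub_distrib]
  refine Finset.sum_nonpos fun e _ => ?_
  by_cases hi : ini e ∈ C <;> by_cases hf : fin e ∈ C <;>
    simp only [hi, hf, if_true, if_false, sub_self, sub_zero, zero_sub, le_refl]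
  · by_contra! h
    exact hf (hC _ hi _ ⟨e, .inl ⟨rfl, rfl, h⟩⟩)
  · by_contra! h
    exact hi (hC _ hf _ ⟨e, .inr ⟨rfl, rfl, neg_pos.1 h⟩⟩)

end Conformal

section Sink

variable {V E ι : Type*} {ini fin : E → V} {t : V} {a : ι → E} {d : E → ℝ}

open scoped Classical in
/-- The vector `d` with its values on the edges into `t` replaced by zero. -/
def awayFrom (fin : E → V) (t : V) (d : E → ℝ) : E → ℝ := fun e => if fin e = t then 0 else d e

theorem IsConformal.of_awayFrom {q : E → ℝ} (hq : IsConformal (awayFrom fin t d) q) :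
    IsConformal d q := fun e => by
  refine (hq e).imp_right fun h => ?_
  by_cases he : fin e = t
  · rw [awayFrom, if_pos he, zero_mul] at h
    exact absurd h (lt_irrefl 0)
  · rwa [awayFrom, if_neg he] at h

theorem ne_of_flowStep_awayFrom (ht : ∀ e, ini e ≠ t) {u v : V}
    (h : FlowStep ini fin (awayFrom fin t d) u v) : v ≠ t := by
  obtain ⟨e, ⟨-, rfl, he⟩ | ⟨-, rfl, -⟩⟩ := h
  · rintro h
    rw [awayFrom, if_pos h] at he
    exact lt_irrefl 0 he
  · exact ht e

variable [DecidableEq V] [Fintype E]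

theorem sum_netflow_eq_add [Fintype ι] (ha : Function.Injective a)
    (hat : ∀ e, fin e = t ↔ e ∈ Set.range a) {C : Finset V} (hC : t ∉ C) :
    ∑ v ∈ C, netflow ini fin d v = (∑ v ∈ C, netflow ini fin (awayFrom fin t d) v) +
      ∑ j, if ini (a j) ∈ C then d (a j) else 0 := by
  have sum_sink : ∑ j, (if ini (a j) ∈ C then d (a j) else 0) =
      ∑ e, if ini e ∈ C then d e - awayFrom fin t d e else 0 := by
    refine Fintype.sum_of_injective a ha _ _ (fun e he => ?_) fun j => ?_
    · rw [awayFrom, if_neg (mt (hat e).1 he), sub_self, ite_self]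
    · rw [awayFrom, if_pos ((hat _).2 ⟨j, rfl⟩), sub_zero]
  have sum_fin : ∑ e, (if fin e ∈ C then awayFrom fin t d e else 0) =
      ∑ e, if fin e ∈ C then d e else 0 := by
    refine Finset.sum_congr rfl fun e _ => if_ctx_congr Iff.rfl (fun he => ?_) fun _ => rfl
    rw [awayFrom, if_neg (ne_of_mem_of_not_mem he hC)]
  rw [sum_netflow, sum_netflow, sum_sink, sum_fin, sub_add_eq_add_sub, ← Finset.sum_add_distrib]
  congr! 2 with e
  split_ifs
  · rw [add_sub_cancel]
  · rw [add_zero]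

theorem exists_reflTransGen_of_sum_neg [Finite V] [Finite ι] (ha : Function.Injective a)
    (hat : ∀ e, fin e = t ↔ e ∈ Set.range a) (ht : ∀ e, ini e ≠ t) (hd : netflow ini fin d = 0)
    {I : Finset ι} (hI : ∑ i ∈ I, d (a i) < 0) :
    ∃ i ∈ I, ∃ j ∉ I, d (a i) < 0 ∧ 0 < d (a j) ∧
      Relation.ReflTransGen (FlowStep ini fin (awayFrom fin t d)) (ini (a i)) (ini (a j)) := by
  classical
  have := Fintype.ofFinite V
  have := Fintype.ofFinite ι
  by_contra! hno
  let C : Finset V := {v | ∃ i ∈ I, d (a i) < 0 ∧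
    Relation.ReflTransGen (FlowStep ini fin (awayFrom fin t d)) (ini (a i)) v}
  have mem_C : ∀ v, v ∈ C ↔ ∃ i ∈ I, d (a i) < 0 ∧
      Relation.ReflTransGen (FlowStep ini fin (awayFrom fin t d)) (ini (a i)) v := fun v => by
    simp only [C, Finset.mem_filter, Finset.mem_univ, true_and]
  have closed : ∀ u ∈ C, ∀ v, FlowStep ini fin (awayFrom fin t d) u v → v ∈ C := by
    intro u hu v huv
    obtain ⟨i, hi, hdi, h⟩ := (mem_C u).1 hu
    exact (mem_C v).2 ⟨i, hi, hdi, h.tail huv⟩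
  have t_notMem : t ∉ C := fun h => by
    obtain ⟨i, -, -, h⟩ := (mem_C t).1 h
    obtain h | ⟨u, -, h⟩ := h.cases_tail
    · exact ht _ h.symm
    · exact ne_of_flowStep_awayFrom ht h rfl
  have sum_le : ∑ j, (if ini (a j) ∈ C then d (a j) else 0) ≤ ∑ i ∈ I, d (a i) := by
    rw [← Finset.univ_inter I, ← Finset.sum_ite_mem]
    refine Finset.sum_le_sum fun j _ => ?_
    by_cases hjC : ini (a j) ∈ C <;> by_cases hjI : j ∈ I <;>
      simp only [hjC, hjI, if_true, if_false, le_refl]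
    · obtain ⟨i, hi, hdi, h⟩ := (mem_C _).1 hjC
      by_contra! hj
      exact hno i hi j hjI hdi hj h
    · by_contra! hj
      exact hjC ((mem_C _).2 ⟨j, hjI, hj, .refl⟩)
  have cut := sum_netflow_eq_add (ini := ini) (d := d) ha hat t_notMem
  rw [hd, Finset.sum_eq_zero fun v _ => Pi.zero_apply v] at cut
  linarith [sum_netflow_nonpos_of_closed closed]

/- The conformal path between the two edges into `t` is closed up through `t`. -/
theorem exists_isConformal_exchange [Finite V] [Finite ι] [DecidableEq ι]
    (ha : Function.Injective a) (hat : ∀ e, fin e = t ↔ e ∈ Set.range a)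
    (ht : ∀ e, ini e ≠ t) (hd : netflow ini fin d = 0) {I : Finset ι}
    (hI : ∑ i ∈ I, d (a i) < 0) :
    ∃ i ∈ I, ∃ j ∉ I, ∃ q, IsConformal d q ∧ netflow ini fin q = 0 ∧
      q ∘ a = Pi.single j 1 - Pi.single i 1 := by
  classical
  obtain ⟨i, hi, j, hj, hdi, hdj, h⟩ := exists_reflTransGen_of_sum_neg ha hat ht hd hI
  obtain ⟨p, hp, hnet⟩ := exists_isConformal_of_reflTransGen h
  have p_sink : ∀ l, p (a l) = 0 := fun l => by
    refine (hp (a l)).resolve_right fun h => ?_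
    rw [awayFrom, if_pos ((hat _).2 ⟨l, rfl⟩), zero_mul] at h
    exact lt_irrefl 0 h
  have fin_a : ∀ l, fin (a l) = t := fun l => (hat _).2 ⟨l, rfl⟩
  refine ⟨i, hi, j, hj, p + (Pi.single (a j) 1 + Pi.single (a i) (-1)), ?_, ?_, ?_⟩
  · exact hp.of_awayFrom.add
      ((isConformal_single (by rwa [mul_one])).add (isConformal_single (by linarith)))
  · rw [map_add, map_add, hnet, netflow_single, netflow_single, fin_a, fin_a]
    module
  · funext l
    simp [p_sink, Pi.single_apply, ha.eq_iff, sub_eq_add_neg, neg_ite]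

end Sink

section CappedFlows

variable {V E ι : Type} [DecidableEq V] [Fintype E] {ini fin : E → V} {b : V → ℝ} {C : Set E}

theorem mem_cappedFlows_of_mem_uIcc {f g h : E → ℝ} (hf : f ∈ cappedFlows ini fin b C)
    (hg : g ∈ cappedFlows ini fin b C) (hh : ∀ e, h e ∈ Set.uIcc (g e) (f e))
    (hnet : netflow ini fin h = netflow ini fin g) : h ∈ cappedFlows ini fin b C := by
  rw [mem_cappedFlows] at hf hg ⊢
  refine ⟨fun e => ?_, hnet.trans hg.2.1, fun e he => ?_⟩
  · exact Set.ordConnected_Ici.uIcc_subset (hg.1 e) (hf.1 e) (hh e)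
  · exact Set.ordConnected_Iic.uIcc_subset (hg.2.2 e he) (hf.2.2 e he) (hh e)

theorem hasExchange_image_cappedFlows [Finite V] [Finite ι] [DecidableEq ι] {t : V} {a : ι → E}
    (ha : Function.Injective a) (hat : ∀ e, fin e = t ↔ e ∈ Set.range a) (ht : ∀ e, ini e ≠ t) :
    HasExchange ((fun f => f ∘ a) '' cappedFlows ini fin b C) := by
  rintro _ ⟨f, hf, rfl⟩ _ ⟨g, hg, rfl⟩ I hI
  have circulation : netflow ini fin (f - g) = 0 := by
    rw [map_sub, (mem_cappedFlows.1 hf).2.1, (mem_cappedFlows.1 hg).2.1, sub_self]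
  have sum_neg : ∑ i ∈ I, (f - g) (a i) < 0 := by
    simpa only [Pi.sub_apply, Function.comp_apply, Finset.sum_sub_distrib, sub_neg] using hI
  obtain ⟨i, hi, j, hj, q, hq, hnet, hqa⟩ :=
    exists_isConformal_exchange ha hat ht circulation sum_neg
  obtain ⟨ε, hε, hbox⟩ := hq.exists_add_smul_mem_uIcc
  refine ⟨i, hi, j, hj, ε, hε, g + ε • q, mem_cappedFlows_of_mem_uIcc hf hg hbox ?_, ?_⟩
  · rw [map_add, map_smul, hnet, smul_zero, add_zero]
  · rw [← hqa]
    rfl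

end CappedFlows

/-! ### Integer points of projected flow polytopes -/

section IntegralValues

variable {V E ι : Type} [DecidableEq V] [Fintype E] {ini fin : E → V} {b : V → ℝ} {C : Set E}
  {a : ι → E}

/-- The restrictions to the edges `a i` of the integral flows. -/
def integralValues (ini fin : E → V) (b : V → ℝ) (C : Set E) (a : ι → E) : Set (ι → ℕ) :=
  (fun m => m ∘ a) '' {m | toReal m ∈ cappedFlows ini fin b C}

theorem image_cappedFlows_eq_convexHull (hb : ∀ v, b v ∈ intSubgroup) :
    (fun f => f ∘ a) '' cappedFlows ini fin b C =
      convexHull ℝ (toReal '' integralValues ini fin b C a) := by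
  have image_toReal : toReal '' integralValues ini fin b C a =
      LinearMap.funLeft ℝ ℝ a '' (toReal '' {m | toReal m ∈ cappedFlows ini fin b C}) := by
    simp only [integralValues, Set.image_image]
    rfl
  rw [image_toReal, ← LinearMap.image_convexHull, ← cappedFlows_eq_convexHull hb]
  rfl

theorem intCast_mem_image_cappedFlows_iff (hb : ∀ v, b v ∈ intSubgroup) (p : ι → ℤ) :
    (fun i => (p i : ℝ)) ∈ (fun f => f ∘ a) '' cappedFlows ini fin b C ↔
      ∃ α ∈ integralValues ini fin b C a, ∀ i, (α i : ℤ) = p i := by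
  constructor
  · rintro ⟨f, hf, hfp⟩
    obtain ⟨m, hm, hmf⟩ := exists_natFlow_eq_on_integers hb hf
    refine ⟨m ∘ a, ⟨m, hm, rfl⟩, fun i => ?_⟩
    have f_eq : f (a i) = p i := congrFun hfp i
    have m_eq := hmf (a i) (f_eq ▸ intCast_mem_intSubgroup (p i))
    exact_mod_cast m_eq.trans f_eq
  · rintro ⟨_, ⟨m, hm, rfl⟩, hmp⟩
    refine ⟨toReal m, hm, funext fun i => ?_⟩
    rw [← hmp i]
    rfl

end IntegralValues

namespace Graph

variable {n : ℕ} {G : Graph n}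

/-! ### The flow polytopes of a graph -/

theorem sum_indeg (G : Graph n) : ∑ j : Fin n, G.indeg j.succ = G.numEdges := by
  have indeg_eq : ∀ v, G.indeg v = (G.edges.map Prod.snd).count v := fun v => by
    rw [Multiset.count_map, indeg, Multiset.countP_eq_card_filter]
    simp only [eq_comm]
  have indeg_zero : G.indeg 0 = 0 :=
    Multiset.countP_eq_zero.2 fun e he => Fin.ne_zero_of_lt (G.increasing e he)
  rw [numEdges, ← Multiset.card_map Prod.snd,
    ← Multiset.sum_count_eq_card fun v _ => Finset.mem_univ v, Fin.sum_univ_succ, ← indeg_eq,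
    indeg_zero, zero_add]
  simp only [indeg_eq]

/-- The part of the netflow at a vertex of `{1, …, n}` coming from the edges `z e` and `y e`. -/
def innerOutflow (f : G.AuxEdge → ℝ) (j : Fin n) : ℝ :=
  ∑ e : G.InnerEdge, ((if e.ini = j then f (.inr (.inl e)) + f (.inr (.inr e)) else 0) -
    (if e.fin = j then f (.inr (.inl e)) else 0))

theorem sum_innerOutflow (f : G.AuxEdge → ℝ) :
    ∑ j, innerOutflow f j = ∑ e, f (.inr (.inr e)) := by
  simp only [innerOutflow]
  rw [Finset.sum_comm]
  refine Finset.sum_congr rfl fun e _ => ?_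
  rw [Finset.sum_sub_distrib, Fintype.sum_ite_eq, Fintype.sum_ite_eq, add_sub_cancel_left]

theorem netflow_aug_coe (f : G.AuxEdge → ℝ) (j : Fin n) :
    netflow G.augIni G.augFin f j = f (.inl j) + innerOutflow f j := by
  rw [netflow_apply, Fintype.sum_sum_type, Fintype.sum_sum_type, Fintype.sum_sum_type,
    Fintype.sum_sum_type, innerOutflow, Finset.sum_sub_distrib]
  simp [augIni, augFin, ite_add_zero, Finset.sum_add_distrib]
  ring

theorem netflow_aug_top (f : G.AuxEdge → ℝ) :
    netflow G.augIni G.augFin f ⊤ = -(∑ j, f (.inl j) + ∑ e, f (.inr (.inr e))) := by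
  simp [netflow_apply, Fintype.sum_sum_type, augIni, augFin]

theorem netflow_level_coe (f : G.AuxEdge → ℝ) (j : Fin n) :
    netflow G.levelIni G.levelFin f (j.castSucc : Fin (n + 1)) =
      f (.inl j) + innerOutflow f j := by
  rw [netflow_apply, Fintype.sum_sum_type, Fintype.sum_sum_type, Fintype.sum_sum_type,
    Fintype.sum_sum_type, innerOutflow, Finset.sum_sub_distrib]
  simp [levelIni, levelFin, ite_add_zero, Finset.sum_add_distrib, (Fin.castSucc_lt_last j).ne']
  ring

theorem netflow_level_last (f : G.AuxEdge → ℝ) :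
    netflow G.levelIni G.levelFin f (Fin.last n : Fin (n + 1)) = -∑ e, f (.inr (.inr e)) := by
  simp [netflow_apply, Fintype.sum_sum_type, levelIni, levelFin, (Fin.castSucc_lt_last _).ne]

theorem netflow_level_top (f : G.AuxEdge → ℝ) :
    netflow G.levelIni G.levelFin f ⊤ = -∑ j, f (.inl j) := by
  simp [netflow_apply, Fintype.sum_sum_type, levelIni, levelFin]

/-- The conservation conditions at the vertices `1, …, n`. -/
def IsConserved (f : G.AuxEdge → ℝ) : Prop :=
  ∀ j, f (.inl j) + innerOutflow f j = G.indeg j.succ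

theorem IsConserved.sum_eq {f : G.AuxEdge → ℝ} (hf : IsConserved f) :
    ∑ j, f (.inl j) + ∑ e, f (.inr (.inr e)) = G.numEdges := by
  rw [← sum_innerOutflow, ← Finset.sum_add_distrib, ← G.sum_indeg, Nat.cast_sum]
  exact Finset.sum_congr rfl fun j _ => hf j

theorem augFlowPolytope_eq_cappedFlows (G : Graph n) : G.augFlowPolytope =
    cappedFlows G.augIni G.augFin G.augNetflow (Set.range G.yEdge) := by
  simp only [augFlowPolytope, cappedFlows, Set.forall_mem_range]

theorem levelFlowPolytope_eq_cappedFlows (G : Graph n) (k : ℕ) : G.levelFlowPolytope k =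
    cappedFlows G.levelIni G.levelFin (G.levelNetflow k) (Set.range G.yEdge) := by
  simp only [levelFlowPolytope, cappedFlows, Set.forall_mem_range]

theorem netflow_aug_eq_iff {f : G.AuxEdge → ℝ} :
    netflow G.augIni G.augFin f = G.augNetflow ↔ IsConserved f := by
  simp only [funext_iff, WithTop.forall, netflow_aug_top, netflow_aug_coe]
  exact ⟨fun h => h.2, fun h => ⟨congrArg Neg.neg h.sum_eq, h⟩⟩

theorem netflow_level_eq_iff {f : G.AuxEdge → ℝ} {k : ℕ} :
    netflow G.levelIni G.levelFin f = G.levelNetflow k ↔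
      IsConserved f ∧ ∑ j, f (G.aEdge j) + k = G.numEdges := by
  simp only [funext_iff, WithTop.forall, Fin.forall_fin_succ', netflow_level_top,
    netflow_level_coe, netflow_level_last, levelNetflow, Fin.lastCases_castSucc,
    Fin.lastCases_last, aEdge]
  constructor
  · rintro ⟨htop, h, -⟩
    exact ⟨h, by linarith⟩
  · rintro ⟨h, hsum⟩
    exact ⟨by linarith, h, by linarith [IsConserved.sum_eq h]⟩

theorem mem_augFlowPolytope {f : G.AuxEdge → ℝ} : f ∈ G.augFlowPolytope ↔
    (∀ e, 0 ≤ f e) ∧ IsConserved f ∧ ∀ e, f (G.yEdge e) ≤ 1 := by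
  rw [augFlowPolytope_eq_cappedFlows, mem_cappedFlows, netflow_aug_eq_iff, Set.forall_mem_range]

theorem mem_levelFlowPolytope {f : G.AuxEdge → ℝ} {k : ℕ} : f ∈ G.levelFlowPolytope k ↔
    f ∈ G.augFlowPolytope ∧ ∑ j, f (G.aEdge j) + k = G.numEdges := by
  rw [levelFlowPolytope_eq_cappedFlows, mem_cappedFlows, netflow_level_eq_iff,
    mem_augFlowPolytope, Set.forall_mem_range]
  tauto

theorem augNetflow_mem_intSubgroup (v : WithTop (Fin n)) : G.augNetflow v ∈ intSubgroup := by
  induction v using WithTop.recTopCoe with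
  | top => exact neg_mem (natCast_mem_intSubgroup _)
  | coe j => exact natCast_mem_intSubgroup _

theorem levelNetflow_mem_intSubgroup (k : ℕ) (v : WithTop (Fin (n + 1))) :
    G.levelNetflow k v ∈ intSubgroup := by
  induction v using WithTop.recTopCoe with
  | top => exact sub_mem (natCast_mem_intSubgroup _) (natCast_mem_intSubgroup _)
  | coe v =>
    induction v using Fin.lastCases with
    | last => simpa only [levelNetflow, Fin.lastCases_last] using
        neg_mem (natCast_mem_intSubgroup k)
    | cast j => simpa only [levelNetflow, Fin.lastCases_castSucc] using natCast_mem_intSubgroup _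

/-! ### Left-degree sequences as integral flows -/

/-- The edges of `G` at the vertex `0`. -/
def rootEdges (G : Graph n) : Multiset (Fin (n + 1) × Fin (n + 1)) :=
  G.edges.filter fun e => ¬ e.1 ≠ 0

/-- All edges of `G`, labelled by `InnerEdge` and the edges at `0`. -/
def edgeLabel (G : Graph n) : G.InnerEdge ⊕ G.rootEdges.ToType → Fin (n + 1) × Fin (n + 1) :=
  Sum.elim (fun e => e.1) fun e => e.1

theorem map_edgeLabel (G : Graph n) :
    (Finset.univ : Finset (G.InnerEdge ⊕ G.rootEdges.ToType)).val.map G.edgeLabel = G.edges := by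
  rw [← Finset.univ_disjSum_univ, Finset.val_disjSum, Multiset.disjSum, Multiset.map_add,
    Multiset.map_map, Multiset.map_map]
  simp only [edgeLabel, Function.comp_def, Sum.elim_inl, Sum.elim_inr, Multiset.map_univ_coe]
  exact Multiset.filter_add_not _ _

/-- The values of an auxiliary flow on the edges `z e` and `y e`, as a flow on the edges of `G`. -/
def innerFlow (m : G.AuxEdge → ℕ) : G.InnerEdge ⊕ G.rootEdges.ToType → ℕ × ℕ :=
  Sum.elim (fun e => (m (.inr (.inl e)), m (G.yEdge e))) 0

theorem edgeLabel_inl_fst_eq_succ_iff {e : G.InnerEdge} {j : Fin n} :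
    (G.edgeLabel (.inl e)).1 = j.succ ↔ e.ini = j := (Fin.pred_eq_iff_eq_succ _).symm

theorem edgeLabel_inl_snd_eq_succ_iff {e : G.InnerEdge} {j : Fin n} :
    (G.edgeLabel (.inl e)).2 = j.succ ↔ e.fin = j := (Fin.pred_eq_iff_eq_succ _).symm

theorem sinkValue_innerFlow (m : G.AuxEdge → ℕ) (j : Fin n) :
    (sinkValue Finset.univ G.edgeLabel (innerFlow m) j.succ : ℝ) =
      G.indeg j.succ - innerOutflow (toReal m) j := by
  have sinkValue_sub : (sinkValue Finset.univ G.edgeLabel 0 j.succ : ℝ) -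
      sinkValue Finset.univ G.edgeLabel (innerFlow m) j.succ = innerOutflow (toReal m) j := by
    rw [sinkValue, sinkValue, ← Int.cast_sub, ← Finset.sum_sub_distrib, Fintype.sum_sum_type,
      Fintype.sum_eq_zero _ fun e : G.rootEdges.ToType => sub_self _, add_zero, Int.cast_sum]
    refine Finset.sum_congr rfl fun e _ => ?_
    simp only [edgeWeight, edgeLabel_inl_fst_eq_succ_iff, edgeLabel_inl_snd_eq_succ_iff, innerFlow,
      Sum.elim_inl, Pi.zero_apply, Prod.fst_zero, Prod.snd_zero, toReal, yEdge]
    split_ifs <;> push_cast <;> ring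
  rw [← sinkValue_sub, sinkValue_zero, map_edgeLabel, ← indeg, Int.cast_natCast, sub_sub_cancel]

theorem innerFlow_mem_integralFlows_iff {α : Fin n → ℕ} {m : G.AuxEdge → ℕ} (hm : m ∘ G.aEdge = α) :
    innerFlow m ∈ integralFlows Finset.univ G.edgeLabel 0 (ReductionTree.extensions α) ↔
      toReal m ∈ G.augFlowPolytope := by
  have support : ∀ e, e ∉ Finset.univ ∨ (G.edgeLabel e).1 = 0 → innerFlow m e = 0 := by
    rintro (e | e) he
    · exact absurd (he.resolve_left (not_not.2 (Finset.mem_univ _))) e.fst_ne_zero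
    · rfl
  have capacity : (∀ e, (innerFlow m e).2 ≤ 1) ↔ ∀ e, toReal m (G.yEdge e) ≤ 1 := by
    simp only [Sum.forall, innerFlow, Sum.elim_inl, Sum.elim_inr, toReal, Nat.cast_le_one,
      Pi.zero_apply, Prod.snd_zero, zero_le, implies_true, and_true]
  have conservation : sinkValue Finset.univ G.edgeLabel (innerFlow m) ∈ ReductionTree.extensions α ↔
      IsConserved (toReal m) := by
    refine forall_congr' fun j => ?_
    rw [← Int.cast_inj (α := ℝ), sinkValue_innerFlow, sub_eq_iff_eq_add, eq_comm, Int.cast_natCast,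
      ← hm]
    rfl
  rw [mem_augFlowPolytope, integralFlows, Set.mem_ofPred_eq, capacity, conservation]
  exact ⟨fun h => ⟨fun e => Nat.cast_nonneg _, h.2.2, h.2.1⟩, fun h => ⟨support, h.2.2, h.2.1⟩⟩

theorem bijOn_innerFlow (α : Fin n → ℕ) :
    Set.BijOn innerFlow {m : G.AuxEdge → ℕ | toReal m ∈ G.augFlowPolytope ∧ m ∘ G.aEdge = α}
      (integralFlows Finset.univ G.edgeLabel 0 (ReductionTree.extensions α)) := by
  refine ⟨fun m hm => (innerFlow_mem_integralFlows_iff hm.2).2 hm.1, fun m hm m' hm' h => ?_,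
    fun f hf => ?_⟩
  · funext e
    rcases e with j | e | e
    · exact congrFun (hm.2.trans hm'.2.symm) j
    · exact congrArg Prod.fst (congrFun h (.inl e))
    · exact congrArg Prod.snd (congrFun h (.inl e))
  · let m : G.AuxEdge → ℕ := Sum.elim α (Sum.elim (fun e => (f (.inl e)).1) fun e => (f (.inl e)).2)
    have innerFlow_m : innerFlow m = f := by
      funext e
      rcases e with e | e
      · rfl
      · have fst_eq_zero := (Multiset.mem_filter.1 (Multiset.coe_mem (m := G.rootEdges) (x := e))).2
        exact (hf.1 (.inr e) (.inr (not_not.1 fst_eq_zero))).symm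
    exact ⟨m, ⟨(innerFlow_mem_integralFlows_iff rfl).1 (innerFlow_m ▸ hf), rfl⟩, innerFlow_m⟩

theorem count_leftDegreeSeqs (T : ReductionTree G) (α : Fin n → ℕ) :
    (T.leftDegreeSeqs.count α : ℕ∞) =
      {m : G.AuxEdge → ℕ | toReal m ∈ G.augFlowPolytope ∧ m ∘ G.aEdge = α}.encard := by
  rw [T.count_leftDegreeSeqs_eq_encard_integralFlows _ _ G.map_edgeLabel,
    ← (bijOn_innerFlow α).image_eq, (bijOn_innerFlow α).injOn.encard_image]

theorem leftDegreeSeqs_eq_LD (T : ReductionTree G) : T.leftDegreeSeqs = G.LD := by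
  classical
  refine Multiset.ext.2 fun α => Nat.cast_injective (R := ℕ∞) ?_
  rw [LD, count_leftDegreeSeqs, count_leftDegreeSeqs]

theorem mem_LD_iff {α : Fin n → ℕ} :
    α ∈ G.LD ↔ ∃ m : G.AuxEdge → ℕ, toReal m ∈ G.augFlowPolytope ∧ m ∘ G.aEdge = α := by
  classical
  rw [← Multiset.count_ne_zero, ← Nat.cast_ne_zero (R := ℕ∞), LD,
    count_leftDegreeSeqs, Set.encard_ne_zero]
  rfl

theorem integralValues_aug :
    integralValues G.augIni G.augFin G.augNetflow (Set.range G.yEdge) G.aEdge = {α | α ∈ G.LD} := by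
  simp only [integralValues, ← augFlowPolytope_eq_cappedFlows, mem_LD_iff]
  rfl

theorem integralValues_level (k : ℕ) :
    integralValues G.levelIni G.levelFin (G.levelNetflow k) (Set.range G.yEdge) G.aEdge =
      {α | α ∈ G.LD ∧ ∑ j, α j + k = G.numEdges} := by
  ext α
  simp only [integralValues, ← levelFlowPolytope_eq_cappedFlows, mem_levelFlowPolytope, mem_LD_iff,
    Set.mem_image, Set.mem_ofPred_eq, ← exists_and_right]
  refine exists_congr fun m => ?_
  rw [and_right_comm]
  refine and_congr_right fun ⟨_, hα⟩ => ?_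
  rw [← hα, ← Nat.cast_inj (R := ℝ), Nat.cast_add, Nat.cast_sum]
  rfl

end Graph

/-! ### Newton polytopes -/

section Newton

variable {n : ℕ} {f : MvPolynomial (Fin n) ℤ}

/-- The exponents of the monomials of `f` with nonzero coefficient, as functions. -/
def exponents (f : MvPolynomial (Fin n) ℤ) : Set (Fin n → ℕ) :=
  Finsupp.equivFunOnFinite.symm ⁻¹' f.support

theorem mem_exponents {α : Fin n → ℕ} :
    α ∈ exponents f ↔ f.coeff (Finsupp.equivFunOnFinite.symm α) ≠ 0 :=
  MvPolynomial.mem_support_iff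

theorem newton_eq_convexHull : newton f = convexHull ℝ (toReal '' exponents f) := by
  rw [newton]
  congr 1
  ext x
  exact Finsupp.equivFunOnFinite.exists_congr_left.trans
    (exists_congr fun α => and_congr mem_exponents.symm eq_comm)

theorem isCompact_newton : IsCompact (newton f) := by
  rw [newton_eq_convexHull]
  exact ((f.support.finite_toSet.preimage
    Finsupp.equivFunOnFinite.symm.injective.injOn).image toReal).isCompact_convexHull ℝ

theorem newton_nonempty (hf : f ≠ 0) : (newton f).Nonempty := by
  obtain ⟨m, hm⟩ := MvPolynomial.ne_zero_iff.1 hf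
  exact ⟨_, subset_convexHull ℝ _ ⟨m, hm, rfl⟩⟩

variable {V E : Type} [DecidableEq V] [Fintype E] {ini fin : E → V} {b : V → ℝ} {C : Set E}
  {a : Fin n → E}

theorem newton_eq_image_cappedFlows (hf : exponents f = integralValues ini fin b C a)
    (hb : ∀ v, b v ∈ intSubgroup) :
    newton f = (fun g => g ∘ a) '' cappedFlows ini fin b C := by
  rw [newton_eq_convexHull, hf, image_cappedFlows_eq_convexHull hb]

theorem intCast_mem_newton_iff (hf : exponents f = integralValues ini fin b C a)
    (hb : ∀ v, b v ∈ intSubgroup) (p : Fin n → ℤ) :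
    (fun i => (p i : ℝ)) ∈ newton f ↔ ∃ α ∈ exponents f, ∀ i, (α i : ℤ) = p i := by
  rw [newton_eq_image_cappedFlows hf hb, intCast_mem_image_cappedFlows_iff hb, hf]

theorem hasPolytopalSupport_of_exponents_eq (hf : exponents f = integralValues ini fin b C a)
    (hb : ∀ v, b v ∈ intSubgroup) : HasPolytopalSupport f := fun p hp =>
  let ⟨α, hα, hαp⟩ := (intCast_mem_newton_iff hf hb p).1 hp
  ⟨Finsupp.equivFunOnFinite.symm α, hαp, mem_exponents.1 hα⟩

end Newton

/-! ### The left-degree polynomial -/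

section Coefficients

variable {n : ℕ}

theorem coeff_neg_one_pow_mul_prod_X_pow (k : ℕ) (α : Fin n → ℕ) (m : Fin n →₀ ℕ) :
    ((-1) ^ k * ∏ i, MvPolynomial.X i ^ α i : MvPolynomial (Fin n) ℤ).coeff m =
      if α = m then (-1) ^ k else 0 := by
  have prod_eq : (∏ i, MvPolynomial.X i ^ α i : MvPolynomial (Fin n) ℤ) =
      MvPolynomial.monomial (Finsupp.equivFunOnFinite.symm α) 1 := by
    rw [MvPolynomial.monomial_eq, Finsupp.prod_fintype _ _ fun i => pow_zero _, map_one, one_mul]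
    rfl
  have sign_eq : ((-1) ^ k : MvPolynomial (Fin n) ℤ) = MvPolynomial.C ((-1) ^ k) := by
    rw [map_pow, map_neg, map_one]
  rw [prod_eq, sign_eq, MvPolynomial.coeff_C_mul, MvPolynomial.coeff_monomial, mul_ite, mul_one,
    mul_zero]
  exact if_congr (Equiv.symm_apply_eq _) rfl rfl

end Coefficients

namespace Graph

variable {n : ℕ} {G : Graph n}

theorem coeff_leftDegreePolynomial (m : Fin n →₀ ℕ) : G.leftDegreePolynomial.coeff m =
    (-1) ^ (G.numEdges - ∑ i, m i) * (G.LD.count ⇑m : ℤ) := by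
  rw [leftDegreePolynomial, Finset.sum_multiset_map_count, MvPolynomial.coeff_sum,
    Finset.sum_eq_single ⇑m]
  · rw [MvPolynomial.coeff_smul, coeff_neg_one_pow_mul_prod_X_pow, if_pos rfl, nsmul_eq_mul,
      mul_comm]
  · intro α _ hα
    rw [MvPolynomial.coeff_smul, coeff_neg_one_pow_mul_prod_X_pow, if_neg hα, smul_zero]
  · intro hm
    rw [Multiset.count_eq_zero.2 (mt Multiset.mem_toFinset.2 hm), zero_smul,
      MvPolynomial.coeff_zero]

theorem coeff_leftDegreeComponent (k : ℕ) (m : Fin n →₀ ℕ) :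
    (G.leftDegreeComponent k).coeff m =
      if ∑ i, m i + k = G.numEdges then G.leftDegreePolynomial.coeff m else 0 := by
  rw [leftDegreeComponent]
  by_cases hk : k ≤ G.numEdges
  · rw [if_pos hk, MvPolynomial.coeff_homogeneousComponent, Finsupp.degree_eq_sum]
    exact if_congr (by omega) rfl rfl
  · rw [if_neg hk, if_neg (by omega), MvPolynomial.coeff_zero]

theorem exponents_leftDegreePolynomial : exponents G.leftDegreePolynomial = {α | α ∈ G.LD} := by
  ext α
  rw [mem_exponents, coeff_leftDegreePolynomial, mul_ne_zero_iff, Nat.cast_ne_zero,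
    Multiset.count_ne_zero, Finsupp.coe_equivFunOnFinite_symm]
  exact and_iff_right (pow_ne_zero _ (by norm_num))

theorem exponents_leftDegreeComponent (k : ℕ) : exponents (G.leftDegreeComponent k) =
    {α | α ∈ G.LD ∧ ∑ j, α j + k = G.numEdges} := by
  ext α
  rw [mem_exponents, coeff_leftDegreeComponent, ne_eq, ite_eq_right_iff, Classical.not_imp,
    ← ne_eq, ← mem_exponents, exponents_leftDegreePolynomial, and_comm]
  rfl

theorem newton_leftDegreePolynomial :
    newton G.leftDegreePolynomial = G.sinkProjection '' G.augFlowPolytope := by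
  rw [augFlowPolytope_eq_cappedFlows]
  exact newton_eq_image_cappedFlows (exponents_leftDegreePolynomial.trans integralValues_aug.symm)
    augNetflow_mem_intSubgroup

theorem intCast_mem_newton_leftDegreePolynomial_iff (p : Fin n → ℤ) :
    (fun i => (p i : ℝ)) ∈ newton G.leftDegreePolynomial ↔ ∃ α ∈ G.LD, ∀ i, (α i : ℤ) = p i := by
  rw [intCast_mem_newton_iff (exponents_leftDegreePolynomial.trans integralValues_aug.symm)
    augNetflow_mem_intSubgroup, exponents_leftDegreePolynomial]
  rfl

theorem hasPolytopalSupport_leftDegreePolynomial : HasPolytopalSupport G.leftDegreePolynomial :=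
  hasPolytopalSupport_of_exponents_eq
    (exponents_leftDegreePolynomial.trans integralValues_aug.symm) augNetflow_mem_intSubgroup

theorem newton_leftDegreeComponent (k : ℕ) :
    newton (G.leftDegreeComponent k) = G.sinkProjection '' G.levelFlowPolytope k := by
  rw [levelFlowPolytope_eq_cappedFlows]
  exact newton_eq_image_cappedFlows
    ((exponents_leftDegreeComponent k).trans (integralValues_level k).symm)
    (levelNetflow_mem_intSubgroup k)

theorem intCast_mem_newton_leftDegreeComponent_iff (k : ℕ) (p : Fin n → ℤ) :
    (fun i => (p i : ℝ)) ∈ newton (G.leftDegreeComponent k) ↔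
      (∃ α ∈ G.LD, ∀ i, (α i : ℤ) = p i) ∧ ∑ i, p i = (G.numEdges : ℤ) - k := by
  rw [intCast_mem_newton_iff
    ((exponents_leftDegreeComponent k).trans (integralValues_level k).symm)
    (levelNetflow_mem_intSubgroup k), exponents_leftDegreeComponent, ← exists_and_right]
  refine exists_congr fun α => ?_
  rw [Set.mem_ofPred_eq, and_assoc, and_assoc]
  refine and_congr_right fun _ => and_comm.trans (and_congr_right fun hαp => ?_)
  rw [eq_sub_iff_add_eq, ← Finset.sum_congr rfl fun i _ => hαp i]
  exact_mod_cast Iff.rfl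

theorem hasPolytopalSupport_leftDegreeComponent (k : ℕ) :
    HasPolytopalSupport (G.leftDegreeComponent k) :=
  hasPolytopalSupport_of_exponents_eq
    ((exponents_leftDegreeComponent k).trans (integralValues_level k).symm)
    (levelNetflow_mem_intSubgroup k)

theorem hasExchange_newton_leftDegreeComponent (k : ℕ) :
    HasExchange (newton (G.leftDegreeComponent k)) := by
  rw [newton_leftDegreeComponent, levelFlowPolytope_eq_cappedFlows]
  refine hasExchange_image_cappedFlows (t := ⊤) (fun _ _ => Sum.inl_injective.eq_iff.1) ?_ ?_
  · rintro (j | e | e) <;> simp [levelFin, aEdge]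
  · rintro (j | e | e) <;> simp [levelIni]

theorem sinkFlowValues_eq_image (k : ℕ) (I : Finset (Fin n)) : G.sinkFlowValues k I =
    (fun t => ∑ i ∈ I, t i) '' newton (G.leftDegreeComponent k) := by
  rw [newton_leftDegreeComponent, Set.image_image]
  exact Set.ext fun s => exists_congr fun f => and_congr_right fun _ => eq_comm

theorem minSinkFlow_eq_minCoordSum (k : ℕ) :
    G.minSinkFlow k = minCoordSum (newton (G.leftDegreeComponent k)) :=
  funext fun I => congrArg sInf (sinkFlowValues_eq_image k I)

theorem hasGreedyMinimizers_newton_leftDegreeComponent {k : ℕ} (hk : G.leftDegreeComponent k ≠ 0) :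
    HasGreedyMinimizers (newton (G.leftDegreeComponent k)) :=
  (hasExchange_newton_leftDegreeComponent k).hasGreedyMinimizers isCompact_newton
    (newton_nonempty hk)

theorem isLeast_minSinkFlow {k : ℕ} (hk : G.leftDegreeComponent k ≠ 0) (I : Finset (Fin n)) :
    IsLeast (G.sinkFlowValues k I) (G.minSinkFlow k I) := by
  rw [sinkFlowValues_eq_image, minSinkFlow_eq_minCoordSum]
  exact (hasGreedyMinimizers_newton_leftDegreeComponent hk).isLeast I

theorem isSupermodular_minSinkFlow {k : ℕ} (hk : G.leftDegreeComponent k ≠ 0) :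
    IsSupermodular (G.minSinkFlow k) := by
  rw [minSinkFlow_eq_minCoordSum]
  exact (hasGreedyMinimizers_newton_leftDegreeComponent hk).isSupermodular

theorem newton_leftDegreeComponent_eq_genPermutahedron {k : ℕ}
    (hk : G.leftDegreeComponent k ≠ 0) :
    newton (G.leftDegreeComponent k) = genPermutahedron (G.minSinkFlow k) := by
  rw [minSinkFlow_eq_minCoordSum]
  exact (hasExchange_newton_leftDegreeComponent k).eq_genPermutahedron isCompact_newton
    (newton_nonempty hk) (convex_convexHull ℝ _)

end Graph

/-! ### Forests -/

section Forest

variable {V E : Type*} [Finite V] [DecidableEq V] [Fintype E] {ini fin : E → V} {H : SimpleGraph V}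

theorem eq_zero_of_netflow_eq_zero (hH : H.IsAcyclic) (hadj : ∀ e, H.Adj (ini e) (fin e))
    (hinj : Function.Injective fun e => s(ini e, fin e)) {d : E → ℝ}
    (hd : netflow ini fin d = 0) : d = 0 := by
  classical
  have := Fintype.ofFinite V
  funext e₀
  -- Without `e₀`, no edge leaves the component `C` of `ini e₀`, so `d e₀` is the netflow of `C`.
  let K := H.deleteEdges {s(ini e₀, fin e₀)}
  let C : Finset V := {v | K.Reachable (ini e₀) v}
  have mem_C : ∀ v, v ∈ C ↔ K.Reachable (ini e₀) v := fun v => by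
    simp only [C, Finset.mem_filter_univ]
  have ini_mem : ini e₀ ∈ C := (mem_C _).2 .rfl
  have fin_notMem : fin e₀ ∉ C := fun h => SimpleGraph.isBridge_iff.1
    (SimpleGraph.isAcyclic_iff_forall_isBridge.1 hH (H.mem_edgeSet.2 (hadj e₀))) ((mem_C _).1 h)
  have mem_iff : ∀ e ≠ e₀, (ini e ∈ C ↔ fin e ∈ C) := fun e he => by
    have K_adj : K.Adj (ini e) (fin e) :=
      SimpleGraph.deleteEdges_adj.2 ⟨hadj e, fun h => he (hinj h)⟩
    rw [mem_C, mem_C]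
    exact ⟨fun h => h.trans K_adj.reachable, fun h => h.trans K_adj.symm.reachable⟩
  calc d e₀ = ∑ e, ((if ini e ∈ C then d e else 0) - if fin e ∈ C then d e else 0) := by
        rw [Fintype.sum_eq_single e₀ fun e he => by simp only [mem_iff e he, sub_self],
          if_pos ini_mem, if_neg fin_notMem, sub_zero]
    _ = ∑ v ∈ C, netflow ini fin d v := by rw [sum_netflow, Finset.sum_sub_distrib]
    _ = 0 := by rw [hd]; exact Finset.sum_const_zero

theorem injective_fst_toType {α : Type*} [DecidableEq α] {s : Multiset α} (hs : s.Nodup) :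
    Function.Injective fun e : s.ToType => e.1 := by
  rintro ⟨x, i⟩ ⟨y, j⟩ rfl
  have : Subsingleton (Fin (s.count x)) :=
    Fin.subsingleton_iff_le_one.2 (Multiset.nodup_iff_count_le_one.1 hs x)
  exact congrArg (Sigma.mk x) (Subsingleton.elim i j)

end Forest

namespace Graph

variable {n : ℕ} {G : Graph n}

theorem InnerEdge.mem_edges (e : G.InnerEdge) : e.1 ∈ G.edges :=
  Multiset.mem_of_mem_filter (Multiset.coe_mem (m := G.innerEdges) (x := e))

theorem InnerEdge.ini_lt_fin (e : G.InnerEdge) : e.ini < e.fin :=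
  Fin.pred_lt_pred_iff.2 (G.increasing _ e.mem_edges)

theorem InnerEdge.adj (e : G.InnerEdge) :
    ((SimpleGraph.fromRel fun u v => (u, v) ∈ G.edges).comap Fin.succ).Adj e.ini e.fin := by
  rw [SimpleGraph.comap_adj, SimpleGraph.fromRel_adj, ini, fin, Fin.succ_pred, Fin.succ_pred]
  exact ⟨(G.increasing _ e.mem_edges).ne, .inl e.mem_edges⟩

theorem InnerEdge.injective_endpoints (hG : G.edges.Nodup) :
    Function.Injective fun e : G.InnerEdge => s(e.ini, e.fin) := by
  intro e e' h
  rcases Sym2.eq_iff.1 h with ⟨hini, hfin⟩ | ⟨hini, hfin⟩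
  · exact injective_fst_toType (hG.filter _) (Prod.ext (Fin.pred_inj.1 hini) (Fin.pred_inj.1 hfin))
  · exact absurd e'.ini_lt_fin (hini ▸ hfin ▸ e.ini_lt_fin.asymm)

theorem yEdge_eq_zero_of_mem_levelFlowPolytope {f : G.AuxEdge → ℝ} (hf : f ∈ G.levelFlowPolytope 0)
    (e : G.InnerEdge) : f (.inr (.inr e)) = 0 := by
  obtain ⟨hf, hsum⟩ := mem_levelFlowPolytope.1 hf
  obtain ⟨nonneg, conserved, -⟩ := mem_augFlowPolytope.1 hf
  have sum_eq_zero : ∑ e, f (.inr (.inr e)) = 0 := by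
    rw [Nat.cast_zero, add_zero] at hsum
    exact add_eq_left.1 (conserved.sum_eq.trans hsum.symm)
  exact (Finset.sum_eq_zero_iff_of_nonneg fun e _ => nonneg _).1 sum_eq_zero e (Finset.mem_univ e)

theorem netflow_innerEdge_of_mem_levelFlowPolytope {f : G.AuxEdge → ℝ}
    (hf : f ∈ G.levelFlowPolytope 0) (j : Fin n) :
    netflow InnerEdge.ini InnerEdge.fin (fun e => f (.inr (.inl e))) j =
      G.indeg j.succ - G.sinkProjection f j := by
  rw [← (mem_augFlowPolytope.1 (mem_levelFlowPolytope.1 hf).1).2.1 j, sinkProjection, aEdge,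
    add_sub_cancel_left, netflow_apply, innerOutflow, Finset.sum_sub_distrib]
  simp only [yEdge_eq_zero_of_mem_levelFlowPolytope hf, add_zero]

theorem IsAcyclic.injOn_levelFlowPolytope (hG : G.IsAcyclic) :
    Set.InjOn G.sinkProjection (G.levelFlowPolytope 0) := by
  intro f hf g hg h
  have netflow_sub : netflow InnerEdge.ini InnerEdge.fin
      ((fun e => f (.inr (.inl e))) - fun e => g (.inr (.inl e))) = 0 := by
    funext j
    rw [map_sub, Pi.sub_apply, netflow_innerEdge_of_mem_levelFlowPolytope hf,
      netflow_innerEdge_of_mem_levelFlowPolytope hg, h, sub_self, Pi.zero_apply]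
  have zEdge_eq := eq_zero_of_netflow_eq_zero
    (hG.2.comap (SimpleGraph.Hom.comap _ _) (Fin.succ_injective n)) InnerEdge.adj
    (InnerEdge.injective_endpoints hG.1) netflow_sub
  funext e
  rcases e with j | e | e
  · exact congrFun h j
  · exact sub_eq_zero.1 (congrFun zEdge_eq e)
  · rw [yEdge_eq_zero_of_mem_levelFlowPolytope hf, yEdge_eq_zero_of_mem_levelFlowPolytope hg]

theorem IsAcyclic.count_LD_le_one (hG : G.IsAcyclic) {α : Fin n → ℕ}
    (hα : ∑ j, α j = G.numEdges) : G.LD.count α ≤ 1 := by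
  have mem_level {m : G.AuxEdge → ℕ} (hm : toReal m ∈ G.augFlowPolytope ∧ m ∘ G.aEdge = α) :
      toReal m ∈ G.levelFlowPolytope 0 := by
    refine mem_levelFlowPolytope.2 ⟨hm.1, ?_⟩
    rw [← hα, ← hm.2, Nat.cast_zero, add_zero, Nat.cast_sum]
    rfl
  rw [← Nat.cast_le (α := ℕ∞), LD, count_leftDegreeSeqs, Nat.cast_one, Set.encard_le_one_iff]
  intro m m' hm hm'
  refine Nat.cast_injective.comp_left
    (hG.injOn_levelFlowPolytope (mem_level hm) (mem_level hm') (funext fun j => ?_))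
  exact congrArg Nat.cast (congrFun (hm.2.trans hm'.2.symm) j)

theorem IsAcyclic.coeff_leftDegreeComponent_zero (hG : G.IsAcyclic) {m : Fin n →₀ ℕ}
    (hm : (G.leftDegreeComponent 0).coeff m ≠ 0) : (G.leftDegreeComponent 0).coeff m = 1 := by
  rw [← Finsupp.equivFunOnFinite_symm_coe m, ← mem_exponents, exponents_leftDegreeComponent] at hm
  obtain ⟨mem_LD, sum_eq⟩ := hm
  have count_eq : G.LD.count ⇑m = 1 :=
    le_antisymm (hG.count_LD_le_one sum_eq) (Multiset.one_le_count_iff_mem.2 mem_LD)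
  rw [coeff_leftDegreeComponent, if_pos sum_eq, coeff_leftDegreePolynomial, count_eq,
    Nat.sub_eq_zero_of_le (add_zero (∑ i, m i) ▸ sum_eq.ge), pow_zero, Nat.cast_one, mul_one]

theorem IsAcyclic.isIntegerPointTransform (hG : G.IsAcyclic) :
    IsIntegerPointTransform (G.leftDegreeComponent 0) (newton (G.leftDegreeComponent 0)) := by
  refine ⟨fun p hp i => ?_, fun m => ⟨fun hm => ?_, fun hm => ?_⟩⟩
  · obtain ⟨⟨α, -, hαp⟩, -⟩ := (intCast_mem_newton_leftDegreeComponent_iff 0 p).1 hp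
    exact hαp i ▸ Int.natCast_nonneg _
  · obtain ⟨m', hm', coeff_ne⟩ := hasPolytopalSupport_leftDegreeComponent 0 (fun i => (m i : ℤ)) hm
    obtain rfl : m' = m := Finsupp.ext fun i => Int.natCast_inj.1 (hm' i)
    exact hG.coeff_leftDegreeComponent_zero coeff_ne
  · by_contra coeff_ne
    exact hm (subset_convexHull ℝ _ ⟨m, coeff_ne, rfl⟩)

end Graph

end LeftDegree

end

theorem theoremB (n : ℕ) (G : LeftDegree.Graph n) :
    (∀ T : LeftDegree.ReductionTree G, T.leftDegreeSeqs = G.LD) ∧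
    LeftDegree.newton G.leftDegreePolynomial = G.sinkProjection '' G.augFlowPolytope ∧
    (∀ p : Fin n → ℤ, (fun i => (p i : ℝ)) ∈ LeftDegree.newton G.leftDegreePolynomial ↔
      ∃ α ∈ G.LD, ∀ i, (α i : ℤ) = p i) ∧
    LeftDegree.HasPolytopalSupport G.leftDegreePolynomial ∧
    (∀ k : ℕ,
      LeftDegree.newton (G.leftDegreeComponent k) =
        G.sinkProjection '' G.levelFlowPolytope k ∧
      (∀ p : Fin n → ℤ, (fun i => (p i : ℝ)) ∈ LeftDegree.newton (G.leftDegreeComponent k) ↔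
        (∃ α ∈ G.LD, ∀ i, (α i : ℤ) = p i) ∧ ∑ i, p i = (G.numEdges : ℤ) - (k : ℤ)) ∧
      LeftDegree.HasPolytopalSupport (G.leftDegreeComponent k) ∧
      (G.leftDegreeComponent k ≠ 0 →
        (∀ I : Finset (Fin n), IsLeast (G.sinkFlowValues k I) (G.minSinkFlow k I)) ∧
        LeftDegree.IsSupermodular (G.minSinkFlow k) ∧
        LeftDegree.newton (G.leftDegreeComponent k) =
          LeftDegree.genPermutahedron (G.minSinkFlow k))) ∧
    (G.IsAcyclic →
      LeftDegree.IsIntegerPointTransform (G.leftDegreeComponent 0)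
        (LeftDegree.newton (G.leftDegreeComponent 0))) := by
  open LeftDegree.Graph in
  exact ⟨leftDegreeSeqs_eq_LD, newton_leftDegreePolynomial,
    intCast_mem_newton_leftDegreePolynomial_iff, hasPolytopalSupport_leftDegreePolynomial,
    fun k => ⟨newton_leftDegreeComponent k, intCast_mem_newton_leftDegreeComponent_iff k,
      hasPolytopalSupport_leftDegreeComponent k, fun hk => ⟨isLeast_minSinkFlow hk,
        isSupermodular_minSinkFlow hk, newton_leftDegreeComponent_eq_genPermutahedron hk⟩⟩,
    IsAcyclic.isIntegerPointTransform⟩
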